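/- Let $(\Sigma,g)$ be a compact connected smooth Riemannian surface without boundary with $Vol_g(\Sigma)=1$ and Riemannian distance $d$. Let $p_1,\dots,p_m\in\Sigma$, let $\alpha_{i,j}\ge 0$ ($i=1,2$, $j=1,\dots,m$), and let $h_1,h_2$ be smooth positive functions on $\Sigma$. For $p \in \Sigma$ let $G_p$ be the Green function, i.e. the solution of $-\Delta G_p=\delta_p-1$ on $\Sigma$ with $\int_\Sigma G_p\,dV_g=0$, and put $\tilde h_i=h_i\,e^{-4\pi\sum_{j}\alpha_{i,j}G_{p_j}}$. For $\rho=(\rho_1,\rho_2)\in\mathbb R^2$ and $u_1,u_2\in H^1(\Sigma)$ let $$J_\rho(u_1,u_2)=\int_\Sigma \tfrac13\left(|\nabla u_1|^2+|\nabla u_2|^2+\nabla u_1\cdot\nabla u_2\right)dV_g+\sum_{i=1}^2\rho_i\left(\int_\Sigma u_i\,dV_g-\log\int_\Sigma\tilde h_i e^{u_i}\,dV_g\right).$$ Let $\gamma_1,\gamma_2\subset\Sigma$ be disjoint simple closed curves which contain none of the points $p_j$. For integers $k,l\ge1$ let $(\gamma_1)_k$ be the set of probability measures $\sum_{i=1}^k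 t_i\delta_{x_i}$ with $t_i\ge0$, $\sum_i t_i=1$, $x_i\in\gamma_1$, define $(\gamma_2)_l$ likewise, and let $(\gamma_1)_k*(\gamma_2)_l$ be their join: the quotient of $(\gamma_1)_k\times(\gamma_2)_l\times[0,1]$ by the identifications $(\sigma_1,\sigma_2,1)\sim(\sigma_1',\sigma_2,1)$ and $(\sigma_1,\sigma_2,0)\sim(\sigma_1,\sigma_2',0)$. For $\lambda>0$ and $\zeta=[(\sigma_1,\sigma_2,r)]$ with $\sigma_1=\sum_{i=1}^k t_i\delta_{x_i}$ and $\sigma_2=\sum_{j=1}^l s_j\delta_{y_j}$ let $$v_1(x)=\log\sum_{i=1}^k t_i\left(\frac1{1+(1-r)^2\lambda^2d(x,x_i)^2}\right)^2,\qquad v_2(x)=\log\sum_{j=1}^l s_j\left(\frac1{1+r^2\lambda^2d(x,y_j)^2}\right)^2,$$ $$\varphi_{\lambda,\zeta}=\left(v_1-\tfrac12v_2,\;-\tfrac12v_1+v_2\right),$$ which depends only on $\lambda$ and $\zeta$. Suppose that $\rho_1\in(4k\pi,4(k+1)\pi)$ and $\rho_2\in(4l\pi,4(l+1)\pi)$.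 Then $\varphi_{\lambda,\zeta}\in H^1(\Sigma)\times H^1(\Sigma)$ for all $\lambda>0$ and $\zeta\in(\gamma_1)_k*(\gamma_2)_l$, and $J_\rho(\varphi_{\lambda,\zeta})\to-\infty$ as $\lambda\to+\infty$, uniformly in $\zeta\in(\gamma_1)_k*(\gamma_2)_l$: for every $L\in\mathbb R$ there is $\lambda_0$ such that $J_\rho(\varphi_{\lambda,\zeta})<L$ for all $\lambda\ge\lambda_0$ and all $\zeta$. -/

import Mathlib

open MeasureTheory Filter Set Bundle
open scoped Manifold ContDiff ENNReal

noncomputable section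

namespace TodaSurface

/-- The model plane. -/
abbrev Plane : Type := EuclideanSpace ℝ (Fin 2)

section Geometry

variable {M : Type*} [MetricSpace M] [ChartedSpace Plane M]

/-- The differential at `y` of the inverse of a chart `e`, applied to the vector `v`: the value at
the point `e.symm y` of the coordinate vector field `∂_v` of the chart. -/
def coordVec (e : OpenPartialHomeomorph M Plane) (y v : Plane) :
    TangentSpace (𝓡 2) (e.symm y) :=
  mfderiv (𝓡 2) (𝓡 2) e.symm y v

variable [RiemannianBundle (fun x : M => TangentSpace (𝓡 2) x)]

/-- The matrix `g_ij` of the Riemannian metric in the chart `e`. -/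
def gramMatrix (e : OpenPartialHomeomorph M Plane) (y : Plane) : Matrix (Fin 2) (Fin 2) ℝ :=
  Matrix.of fun i j =>
    inner ℝ (coordVec e y (EuclideanSpace.single i 1)) (coordVec e y (EuclideanSpace.single j 1))

variable [MeasurableSpace M]

/-- The measure `√(det g_ij) dy` of a chart, as a measure on `M` (concentrated on the domain of the
chart). -/
def chartVolume (e : OpenPartialHomeomorph M Plane) : Measure M :=
  Measure.map e.symm
    (((volume : Measure Plane).restrict e.target).withDensity
      fun y => ENNReal.ofReal (Real.sqrt (gramMatrix e y).det))

variable (M) in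
/-- The Riemannian volume `V_g`: the measure which is `√(det g_ij) dy` in every chart. By the change
of variables formula the measures `chartVolume e` agree on overlaps of chart domains, and their
supremum is the measure that they glue to. -/
def riemannianVolume : Measure M :=
  ⨆ e : atlas Plane M, chartVolume (e : OpenPartialHomeomorph M Plane)

/-- `X` is the weak gradient of `u`: in every chart, the functions `⟨X, ∂_v⟩` are the weak partial
derivatives of `u`, that is, they are locally integrable and satisfy the integration by parts
formula against all smooth compactly supported test functions. -/
structure IsWeakGradient (u : M → ℝ) (X : (x : M) → TangentSpace (𝓡 2) x) : Prop where
  locallyIntegrable_fun : ∀ e ∈ atlas Plane M,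
    LocallyIntegrableOn (fun y => u (e.symm y)) e.target volume
  locallyIntegrable_deriv : ∀ e ∈ atlas Plane M, ∀ v : Plane,
    LocallyIntegrableOn (fun y => inner ℝ (X (e.symm y)) (coordVec e y v)) e.target volume
  integral_by_parts : ∀ e ∈ atlas Plane M, ∀ (v : Plane) (ψ : Plane → ℝ),
    ContDiff ℝ ∞ ψ → HasCompactSupport ψ → tsupport ψ ⊆ e.target →
    ∫ y in e.target, u (e.symm y) * fderiv ℝ ψ y v
      = - ∫ y in e.target, inner ℝ (X (e.symm y)) (coordVec e y v) * ψ y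

open Classical in
/-- The weak gradient of `u` (unique up to null sets), and `0` if there is none. -/
def weakGradient (u : M → ℝ) : (x : M) → TangentSpace (𝓡 2) x :=
  if h : ∃ X, IsWeakGradient u X then h.choose else fun _ => 0

/-- Membership in the Sobolev space `H¹(M)`: `u` and its weak gradient are square integrable. -/
def MemH1 (u : M → ℝ) : Prop :=
  MemLp u 2 (riemannianVolume M) ∧
    ∃ X : (x : M) → TangentSpace (𝓡 2) x, IsWeakGradient u X ∧
      MemLp (fun x => ‖X x‖) 2 (riemannianVolume M)

/-- `G` is the Green function with pole at `p`, that is, the solution of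
`-Δ G = δ_p - 1 / |M|` with mean value zero. The equation is understood weakly: `G` has an
integrable weak gradient, and `∫ ⟨∇G, ∇ψ⟩ = ψ(p) - ⨍ ψ` for every smooth `ψ`. Such a `G` is unique
up to null sets; we take the representative which is continuous away from the pole. -/
structure IsGreenFunction (p : M) (G : M → ℝ) : Prop where
  continuousOn : ContinuousOn G {p}ᶜ
  integrable : Integrable G (riemannianVolume M)
  integral_eq_zero : ∫ x, G x ∂(riemannianVolume M) = 0
  equation : ∃ X : (x : M) → TangentSpace (𝓡 2) x, IsWeakGradient G X ∧
    Integrable (fun x => ‖X x‖) (riemannianVolume M) ∧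
    ∀ ψ : M → ℝ, ContMDiff (𝓡 2) 𝓘(ℝ, ℝ) ∞ ψ →
      ∫ x, (mfderiv (𝓡 2) 𝓘(ℝ, ℝ) ψ x (X x) : ℝ) ∂(riemannianVolume M)
        = ψ p - ⨍ x, ψ x ∂(riemannianVolume M)

open Classical in
/-- The Green function `G_p`. -/
def greenFunction (p : M) : M → ℝ :=
  if h : ∃ G, IsGreenFunction p G then h.choose else fun _ => 0

/-- The singular weight `h exp(-4π ∑ⱼ αⱼ G_{pⱼ})`. -/
def singularWeight {m : ℕ} (p : Fin m → M) (α : Fin m → ℝ) (h : M → ℝ) (x : M) : ℝ :=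
  h x * Real.exp (-(4 * Real.pi) * ∑ j, α j * greenFunction (p j) x)

/-- The quadratic form `Q(u₁, u₂) = (|∇u₁|² + |∇u₂|² + ∇u₁ · ∇u₂) / 3`. -/
def quadForm (u₁ u₂ : M → ℝ) (x : M) : ℝ :=
  1 / 3 * (‖weakGradient u₁ x‖ ^ 2 + ‖weakGradient u₂ x‖ ^ 2
    + inner ℝ (weakGradient u₁ x) (weakGradient u₂ x))

/-- The functional
`J_ρ(u₁, u₂) = ∫ Q(u₁, u₂) + ∑ᵢ ρᵢ (∫ uᵢ - log ∫ wᵢ exp uᵢ)` with weights `w₁, w₂ ≥ 0`.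
The integrals of the nonnegative functions `wᵢ exp uᵢ` and their logarithms are taken in the
extended sense, so that no convention about divergent integrals or `log 0` enters. -/
def todaFunctional (ρ₁ ρ₂ : ℝ) (w₁ w₂ u₁ u₂ : M → ℝ) : EReal :=
  ((∫ x, quadForm u₁ u₂ x ∂(riemannianVolume M) : ℝ) : EReal)
    + (ρ₁ : EReal) * (((∫ x, u₁ x ∂(riemannianVolume M) : ℝ) : EReal)
        - ENNReal.log (∫⁻ x, ENNReal.ofReal (w₁ x * Real.exp (u₁ x)) ∂(riemannianVolume M)))
    + (ρ₂ : EReal) * (((∫ x, u₂ x ∂(riemannianVolume M) : ℝ) : EReal)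
        - ENNReal.log (∫⁻ x, ENNReal.ofReal (w₂ x * Real.exp (u₂ x)) ∂(riemannianVolume M)))

end Geometry

section Join

/-- The relation generating the identifications in the topological join:
`(a₁, b, 1) ∼ (a₂, b, 1)` and `(a, b₁, 0) ∼ (a, b₂, 0)`. -/
inductive JoinRel (A B : Type*) : A × B × unitInterval → A × B × unitInterval → Prop
  | one (a₁ a₂ : A) (b : B) : JoinRel A B (a₁, b, 1) (a₂, b, 1)
  | zero (a : A) (b₁ b₂ : B) : JoinRel A B (a, b₁, 0) (a, b₂, 0)

/-- The join `A * B`, the quotient of `A × B × [0, 1]` by the equivalence relation generated by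
`JoinRel`. -/
def Join (A B : Type*) : Type _ := Quot (JoinRel A B)

end Join

section TestFunctions

variable {M : Type*} [MetricSpace M] [MeasurableSpace M]

/-- The formal barycenters `γ_k`: the probability measures `∑ⱼ tⱼ δ_{xⱼ}` with `k` points
`xⱼ ∈ γ` (not necessarily distinct). -/
def barycenters (γ : Set M) (k : ℕ) : Set (Measure M) :=
  {σ | ∃ (t : Fin k → ℝ) (x : Fin k → M), (∀ j, 0 ≤ t j) ∧ ∑ j, t j = 1 ∧ (∀ j, x j ∈ γ) ∧
    σ = ∑ j, ENNReal.ofReal (t j) • Measure.dirac (x j)}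

/-- `v(x) = log ∫ (1 / (1 + μ² d(x, z)²))² dσ(z)`. For `σ = ∑ⱼ tⱼ δ_{xⱼ}` this is
`log ∑ⱼ tⱼ (1 / (1 + μ² d(x, xⱼ)²))²`, see `logBubble_sum`. -/
def logBubble (μ : ℝ) (σ : Measure M) (x : M) : ℝ :=
  Real.log (∫ z, (1 / (1 + μ ^ 2 * dist x z ^ 2)) ^ 2 ∂σ)

theorem logBubble_sum [BorelSpace M] {k : ℕ} (μ : ℝ) (t : Fin k → ℝ) (ht : ∀ j, 0 ≤ t j)
    (y : Fin k → M) (x : M) :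
    logBubble μ (∑ j, ENNReal.ofReal (t j) • Measure.dirac (y j)) x
      = Real.log (∑ j, t j * (1 / (1 + μ ^ 2 * dist x (y j) ^ 2)) ^ 2) := by
  unfold logBubble
  congr 1
  rw [integral_finsetSum_measure]
  · refine Finset.sum_congr rfl fun j _ => ?_
    rw [integral_smul_measure, integral_dirac, ENNReal.toReal_ofReal (ht j), smul_eq_mul]
  · intro j _
    exact (integrable_dirac (by simp)).smul_measure ENNReal.ofReal_ne_top

theorem isProbabilityMeasure_of_mem_barycenters {γ : Set M} {k : ℕ} {σ : Measure M}
    (hσ : σ ∈ barycenters γ k) : IsProbabilityMeasure σ := by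
  obtain ⟨t, x, ht, hsum, -, rfl⟩ := hσ
  refine ⟨?_⟩
  simp only [Measure.coe_finsetSum, Finset.sum_apply, Measure.smul_apply, measure_univ,
    smul_eq_mul, mul_one]
  rw [← ENNReal.ofReal_sum_of_nonneg fun j _ => ht j, hsum, ENNReal.ofReal_one]

theorem logBubble_zero {γ : Set M} {k : ℕ} {σ : Measure M} (hσ : σ ∈ barycenters γ k) (x : M) :
    logBubble 0 σ x = 0 := by
  have := isProbabilityMeasure_of_mem_barycenters hσ
  simp [logBubble]

/-- The two components of the test function attached to a triple `(σ₁, σ₂, r)`, with the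
concentration parameters `(1 - r) lam` for `σ₁` and `r lam` for `σ₂`. -/
def preTestFunction (lam : ℝ) (σ₁ σ₂ : Measure M) (r : ℝ) : (M → ℝ) × (M → ℝ) :=
  (fun x => logBubble ((1 - r) * lam) σ₁ x - 1 / 2 * logBubble (r * lam) σ₂ x,
   fun x => -(1 / 2) * logBubble ((1 - r) * lam) σ₁ x + logBubble (r * lam) σ₂ x)

/-- The test function `φ_{lam, ζ}`, for `ζ` in the join of the sets of barycenters. -/
def testFunction {Γ₁ Γ₂ : Set M} {k l : ℕ} (lam : ℝ)
    (ζ : Join (barycenters Γ₁ k) (barycenters Γ₂ l)) : (M → ℝ) × (M → ℝ) :=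
  Quot.lift (fun q : barycenters Γ₁ k × barycenters Γ₂ l × unitInterval =>
      preTestFunction lam (q.1 : Measure M) (q.2.1 : Measure M) (q.2.2 : ℝ))
    (by
      intro a b hab
      cases hab with
      | one a₁ a₂ b => simp [preTestFunction, logBubble_zero a₁.2, logBubble_zero a₂.2]
      | zero a b₁ b₂ => simp [preTestFunction, logBubble_zero b₁.2, logBubble_zero b₂.2]) ζ

end TestFunctions

end TodaSurface

end

/-!
The test functions are combinations of the two bubbles
`v₁ = log ∑ tᵢ (1 + Λ₁² d(·, xᵢ)²)⁻²` and `v₂ = log ∑ sⱼ (1 + Λ₂² d(·, yⱼ)²)⁻²`, where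
`Λ₁ = (1 - r) λ` and `Λ₂ = r λ`. Put `Lᵢ = log max(1, Λᵢ)`. Each term of the functional is bounded
above by an affine function of `L₁` and `L₂`, uniformly in the weights and in the centres.

*Energy.* The quadratic form of `(v₁ - v₂ / 2, -v₁ / 2 + v₂)` is
`(|∇v₁|² + |∇v₂|² - ∇v₁ · ∇v₂) / 4` (`quadForm_ae_eq`). The gradient of a bubble is at most `2 Λ`,
and at most `4 / d` at distance `d` from its nearest centre, so that its square is at most
`4 ∑ᵢ 4 / max(d(·, xᵢ), 2 / Λ)²` (`norm_gradient_bubble_sq_le`). As the two curves are disjoint, one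
of the gradients is bounded wherever the other one is large, and Young's inequality absorbs the
mixed term (`norm_gradient_mul_le`). The integral of `4 / max(d(·, z), 2 / Λ)²` is at most
`8 π (1 + ε) log Λ + C` by the layer cake formula (`exists_integral_truncInvSq_le`), provided that
small balls have area at most `(1 + ε) π s²`. Hence the energy is at most
`(1 + ε)² 8 π (k L₁ + l L₂) + C` (`integral_quadForm_le`).

*Mean values and masses.* The mean value of `vᵢ` is `-4 Lᵢ` up to `O(ε Lᵢ) + C`
(`integral_bubble_le`, `le_integral_bubble`). A disc of radius about `1 / Λ₁` around a centre of
weight at least `1 / k` shows that the mass of `exp (v₁ - v₂ / 2)` is at least `c exp (2 L₂ - 2 L₁)`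
(`exists_le_lintegral_exp`); only the positivity and continuity of the weight near the curve enter,
and these hold because the curve avoids the singular points. In the difference of the mean value and
the logarithm of the mass the `L₂` terms cancel, and `-2 L₁` remains.

*Conclusion.* The coefficient of `L₁` in the bound for the functional is `8 π k - 2 ρ₁ + O(ε)`,
which is negative for small `ε` since `ρ₁ > 4 k π`; likewise for `L₂` (`exists_todaFunctional_le`).
As one of `Λ₁`, `Λ₂` is at least `λ / 2`, the sum `L₁ + L₂` tends to infinity with `λ`, uniformly in the
point of the join.

The geometric input is that a continuous metric is, near a point and up to factors close to `1`, a
constant metric on the plane (`exists_ball_norm_coordVec_le`). It gives the areas of small balls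
(`exists_volume_ball`) and the bound of a gradient by the pointwise Lipschitz constant
(`norm_gradient_le`). The bubbles are Lipschitz; by Rademacher's theorem in charts, the pointwise
gradient of a Lipschitz function is its weak gradient (`isWeakGradient_gradient`), so that Lipschitz
functions lie in `H¹` (`memH1_of_lipschitz`), and weak gradients are unique up to null sets
(`IsWeakGradient.ae_eq`).
-/

noncomputable section

namespace TodaSurface

/-! ### Charts and coordinate vectors -/

section Charts

variable {M : Type*} [MetricSpace M] [ChartedSpace Plane M]

lemma coordVec_add (e : OpenPartialHomeomorph M Plane) (y v w : Plane) :
    coordVec e y (v + w) = coordVec e y v + coordVec e y w :=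
  map_add (mfderiv (𝓡 2) (𝓡 2) e.symm y) v w

lemma coordVec_smul (e : OpenPartialHomeomorph M Plane) (y : Plane) (c : ℝ) (v : Plane) :
    coordVec e y (c • v) = c • coordVec e y v :=
  map_smul (mfderiv (𝓡 2) (𝓡 2) e.symm y) c v

lemma inner_tangent_congr [RiemannianBundle (fun x : M => TangentSpace (𝓡 2) x)] {x x' : M}
    (h : x = x') (v w : Plane) :
    (inner ℝ (show TangentSpace (𝓡 2) x from v) (show TangentSpace (𝓡 2) x from w) : ℝ)
      = inner ℝ (show TangentSpace (𝓡 2) x' from v) (show TangentSpace (𝓡 2) x' from w) := by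
  subst h; rfl

variable [IsManifold (𝓡 2) 1 M] {e : OpenPartialHomeomorph M Plane}

lemma mdifferentiable_chart (he : e ∈ atlas Plane M) : e.MDifferentiable (𝓡 2) (𝓡 2) :=
  mdifferentiable_of_mem_atlas he

/-- The differential of an inverse chart, as a linear equivalence. -/
def coordEquiv (he : e ∈ atlas Plane M) {y : Plane} (hy : y ∈ e.target) :
    Plane ≃L[ℝ] TangentSpace (𝓡 2) (e.symm y) :=
  (mdifferentiable_chart he).symm.mfderiv hy

lemma coordEquiv_apply (he : e ∈ atlas Plane M) {y : Plane} (hy : y ∈ e.target) (v : Plane) :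
    coordEquiv he hy v = coordVec e y v := rfl

variable [RiemannianBundle (fun x : M => TangentSpace (𝓡 2) x)]

lemma continuousOn_inner_coordVec
    [IsContinuousRiemannianBundle Plane (fun x : M => TangentSpace (𝓡 2) x)]
    (he : e ∈ atlas Plane M) (v w : Plane) :
    ContinuousOn (fun y => (inner ℝ (coordVec e y v) (coordVec e y w) : ℝ)) e.target := by
  have key : ∀ v : Plane, ContinuousOn (fun y => (⟨e.symm y, coordVec e y v⟩ :
      TotalSpace Plane (fun x : M => TangentSpace (𝓡 2) x))) e.target := by
    intro v
    have h1 : ContMDiffOn (𝓡 2) (𝓡 2) 1 e.symm e.target := contMDiffOn_symm_of_mem_maximalAtlas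
      (IsManifold.subset_maximalAtlas he)
    have h2 := h1.continuousOn_tangentMapWithin le_rfl e.open_target.uniqueMDiffOn
    have h3 : Continuous (fun y : Plane => (⟨y, v⟩ : TangentBundle (𝓡 2) Plane)) := by
      have : (fun y : Plane => (⟨y, v⟩ : TangentBundle (𝓡 2) Plane))
         = fun y => (tangentBundleModelSpaceHomeomorph (𝓡 2)).symm (y, v) := by
        ext y
        · simp
        · exact HEq.rfl
      rw [this]
      fun_prop
    refine (h2.comp h3.continuousOn (fun y hy => hy)).congr fun y hy => ?_
    simp only [tangentMapWithin, Function.comp, coordVec]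
    rw [mfderivWithin_of_isOpen e.open_target hy]
  exact ContinuousOn.inner_bundle (key v) (key w)

end Charts

/-! ### Gram determinants -/

section Gram

variable {V : Type*} [NormedAddCommGroup V] [InnerProductSpace ℝ V]

lemma plane_eq_sum (v : Plane) :
    v = v 0 • EuclideanSpace.single 0 1 + v 1 • EuclideanSpace.single 1 1 := by
  ext i
  fin_cases i <;> simp

/-- The Gram determinant is multiplied by the square of the determinant under a linear change of
variables. -/
lemma det_gram_comp (f : Plane →ₗ[ℝ] V) (T : Plane →L[ℝ] Plane) :
    (Matrix.of fun i j : Fin 2 => (inner ℝ (f (T (EuclideanSpace.single i 1)))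
      (f (T (EuclideanSpace.single j 1))) : ℝ)).det
      = T.det ^ 2 * (Matrix.of fun i j : Fin 2 => (inner ℝ (f (EuclideanSpace.single i 1))
      (f (EuclideanSpace.single j 1)) : ℝ)).det := by
  have hT : T.det = T (EuclideanSpace.single 0 1) 0 * T (EuclideanSpace.single 1 1) 1
      - T (EuclideanSpace.single 1 1) 0 * T (EuclideanSpace.single 0 1) 1 := by
    rw [ContinuousLinearMap.det,
      ← LinearMap.det_toMatrix (EuclideanSpace.basisFun (Fin 2) ℝ).toBasis, Matrix.det_fin_two]
    simp [LinearMap.toMatrix_apply]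
  rw [hT, Matrix.det_fin_two, Matrix.det_fin_two]
  simp only [Matrix.of_apply]
  rw [plane_eq_sum (T (EuclideanSpace.single 0 1)), plane_eq_sum (T (EuclideanSpace.single 1 1))]
  simp only [map_add, map_smul, inner_add_left, inner_add_right, real_inner_smul_left,
    real_inner_smul_right, PiLp.add_apply, PiLp.smul_apply, PiLp.single_apply]
  rw [real_inner_comm (f (EuclideanSpace.single 0 1)) (f (EuclideanSpace.single 1 1))]
  simp
  ring

lemma det_gram_eq_sq (f : Plane →ₗ[ℝ] V) (A : Plane →L[ℝ] Plane) (hA : ∀ v, ‖A v‖ = ‖f v‖) :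
    (Matrix.of fun i j : Fin 2 => (inner ℝ (f (EuclideanSpace.single i 1))
      (f (EuclideanSpace.single j 1)) : ℝ)).det = A.det ^ 2 := by
  have h : ∀ v w, (inner ℝ (f v) (f w) : ℝ) = inner ℝ (A v) (A w) := by
    intro v w
    rw [real_inner_eq_norm_add_mul_self_sub_norm_mul_self_sub_norm_mul_self_div_two,
      real_inner_eq_norm_add_mul_self_sub_norm_mul_self_sub_norm_mul_self_div_two,
      ← map_add, ← map_add, hA, hA, hA]
  simp only [h]
  have := det_gram_comp (LinearMap.id : Plane →ₗ[ℝ] Plane) A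
  simp only [LinearMap.id_apply] at this
  rw [this, Matrix.det_fin_two]
  simp [EuclideanSpace.inner_single_left]

/-- A norm on the plane that comes from an inner product is the pullback of the Euclidean norm. -/
lemma exists_normEquiv (f : Plane ≃L[ℝ] V) : ∃ A : Plane ≃L[ℝ] Plane, ∀ v, ‖A v‖ = ‖f v‖ := by
  have : FiniteDimensional ℝ V := f.toLinearEquiv.finiteDimensional
  have hd : Module.finrank ℝ V = 2 := by
    rw [← f.toLinearEquiv.finrank_eq]; simp
  let i := ((stdOrthonormalBasis ℝ V).reindex (finCongr hd)).repr
  exact ⟨f.trans i.toContinuousLinearEquiv, fun v => by simp⟩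

end Gram

/-! ### The Riemannian volume in charts -/

section Measurability

variable {M : Type*} [MetricSpace M] [MeasurableSpace M] [BorelSpace M]

lemma measurableSet_target_inter (e : OpenPartialHomeomorph M Plane) {A : Set M}
    (hA : MeasurableSet A) : MeasurableSet (e.target ∩ e.symm ⁻¹' A) := by
  have h : Measurable (e.target.domRestrict e.symm) :=
    (continuousOn_iff_continuous_domRestrict.1 e.continuousOn_symm).measurable
  have := (MeasurableEmbedding.subtype_coe e.open_target.measurableSet).measurableSet_image.2 (h hA)
  convert this using 1
  ext y
  simp [Set.domRestrict, and_comm]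

lemma measurableSet_source_inter (e : OpenPartialHomeomorph M Plane) {A : Set Plane}
    (hA : MeasurableSet A) : MeasurableSet (e.source ∩ e ⁻¹' A) := by
  have h : Measurable (e.source.domRestrict e) :=
    (continuousOn_iff_continuous_domRestrict.1 e.continuousOn).measurable
  have := (MeasurableEmbedding.subtype_coe e.open_source.measurableSet).measurableSet_image.2 (h hA)
  convert this using 1
  ext y
  simp [Set.domRestrict, and_comm]

lemma aemeasurable_symm (e : OpenPartialHomeomorph M Plane) :
    AEMeasurable e.symm ((volume : Measure Plane).restrict e.target) :=
  e.continuousOn_symm.aemeasurable e.open_target.measurableSet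

variable [ChartedSpace Plane M] [RiemannianBundle (fun x : M => TangentSpace (𝓡 2) x)]

lemma chartVolume_apply (e : OpenPartialHomeomorph M Plane) {A : Set M} (hA : MeasurableSet A) :
    chartVolume e A = ∫⁻ y in e.target ∩ e.symm ⁻¹' A,
      ENNReal.ofReal (Real.sqrt (gramMatrix e y).det) := by
  unfold chartVolume
  rw [Measure.map_apply_of_aemeasurable
    ((aemeasurable_symm e).mono_ac (withDensity_absolutelyContinuous _ _)) hA,
    withDensity_apply', Measure.restrict_restrict' e.open_target.measurableSet, inter_comm]

lemma chartVolume_compl_source (e : OpenPartialHomeomorph M Plane) :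
    chartVolume e e.sourceᶜ = 0 := by
  rw [chartVolume_apply e e.open_source.measurableSet.compl]
  have : e.target ∩ e.symm ⁻¹' e.sourceᶜ = ∅ := by
    ext y
    simp only [mem_inter_iff, mem_preimage, mem_compl_iff, mem_empty_iff_false, iff_false, not_and,
      not_not]
    exact fun hy => e.map_target hy
  rw [this]
  simp

end Measurability

section Volume

variable {M : Type*} [MetricSpace M] [ChartedSpace Plane M] [IsManifold (𝓡 2) 1 M]
  {e e' : OpenPartialHomeomorph M Plane}

/-- The coordinate vectors of two charts are related by the differential of the transition map. -/
lemma coordVec_transition (he : e ∈ atlas Plane M) (he' : e' ∈ atlas Plane M) {y : Plane}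
    (hy : y ∈ e'.target) (hy' : e'.symm y ∈ e.source) :
    DifferentiableAt ℝ (fun z => e (e'.symm z)) y ∧
    ∀ v : Plane, (coordVec e' y v : Plane)
      = coordVec e (e (e'.symm y)) (fderiv ℝ (fun z => e (e'.symm z)) y v) := by
  have h1 : MDifferentiableAt (𝓡 2) (𝓡 2) (fun z => e (e'.symm z)) y :=
    (mdifferentiableAt_atlas he hy').comp y (mdifferentiableAt_atlas_symm he' hy)
  refine ⟨mdifferentiableAt_iff_differentiableAt.1 h1, fun v => ?_⟩
  have h2 : e'.symm =ᶠ[nhds y] e.symm ∘ (fun z => e (e'.symm z)) := by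
    have : e'.symm ⁻¹' e.source ∈ nhds y :=
      (e'.continuousAt_symm hy).preimage_mem_nhds (e.open_source.mem_nhds hy')
    filter_upwards [this] with z hz
    simp [e.left_inv hz]
  have h3 : mfderiv (𝓡 2) (𝓡 2) (e.symm ∘ (fun z => e (e'.symm z))) y
      = (mfderiv (𝓡 2) (𝓡 2) e.symm (e (e'.symm y))).comp
        (mfderiv (𝓡 2) (𝓡 2) (fun z => e (e'.symm z)) y) :=
    mfderiv_comp y (mdifferentiableAt_atlas_symm he (e.map_source hy')) h1
  have h4 := h2.mfderiv_eq (I := 𝓡 2) (I' := 𝓡 2)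
  unfold coordVec
  have h5 : (mfderiv (𝓡 2) (𝓡 2) e'.symm y : Plane →L[ℝ] Plane)
    = mfderiv (𝓡 2) (𝓡 2) (e.symm ∘ (fun z => e (e'.symm z))) y := h4
  have h6 : mfderiv (𝓡 2) (𝓡 2) (fun z => e (e'.symm z)) y
    = fderiv ℝ (fun z => e (e'.symm z)) y := mfderiv_eq_fderiv
  rw [← h6]
  exact (congrArg (fun L : Plane →L[ℝ] Plane => L v) (h5.trans h3))

variable [RiemannianBundle (fun x : M => TangentSpace (𝓡 2) x)]

lemma inner_coordVec_transition (he : e ∈ atlas Plane M) (he' : e' ∈ atlas Plane M) {y : Plane}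
    (hy : y ∈ e'.target) (hy' : e'.symm y ∈ e.source) (v w : Plane) :
    (inner ℝ (coordVec e' y v) (coordVec e' y w) : ℝ)
      = inner ℝ (coordVec e (e (e'.symm y)) (fderiv ℝ (fun z => e (e'.symm z)) y v))
        (coordVec e (e (e'.symm y)) (fderiv ℝ (fun z => e (e'.symm z)) y w)) := by
  have h := (coordVec_transition he he' hy hy').2
  have h1 := inner_tangent_congr (e.left_inv hy') (coordVec e' y v) (coordVec e' y w)
  refine h1.symm.trans ?_
  rw [h v, h w]

/-- The differential of an inverse chart, as a linear map. -/
def coordLinear (e : OpenPartialHomeomorph M Plane) (y : Plane) :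
    Plane →ₗ[ℝ] TangentSpace (𝓡 2) (e.symm y) where
  toFun := coordVec e y
  map_add' := coordVec_add e y
  map_smul' := coordVec_smul e y

lemma gramMatrix_det_transition (he : e ∈ atlas Plane M) (he' : e' ∈ atlas Plane M) {y : Plane}
    (hy : y ∈ e'.target) (hy' : e'.symm y ∈ e.source) :
    (gramMatrix e' y).det = (fderiv ℝ (fun z => e (e'.symm z)) y).det ^ 2 *
      (gramMatrix e (e (e'.symm y))).det := by
  have := det_gram_comp (coordLinear e (e (e'.symm y))) (fderiv ℝ (fun z => e (e'.symm z)) y)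
  unfold gramMatrix
  rw [Matrix.det_fin_two, Matrix.det_fin_two] at *
  simp only [Matrix.of_apply] at *
  simp only [inner_coordVec_transition he he' hy hy']
  exact this

lemma det_gramMatrix_pos (he : e ∈ atlas Plane M) {y : Plane} (hy : y ∈ e.target) :
    0 < (gramMatrix e y).det := by
  obtain ⟨A, hA⟩ := exists_normEquiv (coordEquiv he hy)
  have h : (gramMatrix e y).det = (A : Plane →L[ℝ] Plane).det ^ 2 :=
    det_gram_eq_sq (coordLinear e y) A hA
  rw [h]
  have : (A : Plane →L[ℝ] Plane).det ≠ 0 := (LinearEquiv.isUnit_det' A.toLinearEquiv).ne_zero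
  positivity

lemma continuousOn_det_gramMatrix
    [IsContinuousRiemannianBundle Plane (fun x : M => TangentSpace (𝓡 2) x)]
    (he : e ∈ atlas Plane M) :
    ContinuousOn (fun y => (gramMatrix e y).det) e.target := by
  simp only [Matrix.det_fin_two, gramMatrix, Matrix.of_apply]
  exact ((continuousOn_inner_coordVec he _ _).mul (continuousOn_inner_coordVec he _ _)).sub
    ((continuousOn_inner_coordVec he _ _).mul (continuousOn_inner_coordVec he _ _))

variable [MeasurableSpace M] [BorelSpace M]

/-- The change of variables formula: two chart measures agree on the overlap. -/
lemma chartVolume_eq_of_subset (he : e ∈ atlas Plane M) (he' : e' ∈ atlas Plane M) {A : Set M}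
    (hA : MeasurableSet A) (h : A ⊆ e.source) (h' : A ⊆ e'.source) :
    chartVolume e' A = chartVolume e A := by
  rw [chartVolume_apply e hA, chartVolume_apply e' hA]
  have him : (fun z => e (e'.symm z)) '' (e'.target ∩ e'.symm ⁻¹' A)
      = e.target ∩ e.symm ⁻¹' A := by
    ext y
    constructor
    · rintro ⟨z, ⟨hz, hzA⟩, rfl⟩
      exact ⟨e.map_source (h hzA), by simpa [e.left_inv (h hzA)] using hzA⟩
    · rintro ⟨hy, hyA⟩
      refine ⟨e' (e.symm y), ⟨e'.map_source (h' hyA), ?_⟩, ?_⟩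
      · simpa [e'.left_inv (h' hyA)] using hyA
      · simp [e'.left_inv (h' hyA), e.right_inv hy]
  rw [← him, lintegral_image_eq_lintegral_abs_det_fderiv_mul volume
    (measurableSet_target_inter e' hA)
    (f' := fun y => fderiv ℝ (fun z => e (e'.symm z)) y)]
  · refine setLIntegral_congr_fun (measurableSet_target_inter e' hA) fun y hy => ?_
    rw [gramMatrix_det_transition he he' hy.1 (h hy.2), Real.sqrt_mul (sq_nonneg _),
      Real.sqrt_sq_eq_abs, ENNReal.ofReal_mul (abs_nonneg _)]
  · intro y hy
    exact (coordVec_transition he he' hy.1 (h hy.2)).1.hasFDerivAt.hasFDerivWithinAt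
  · intro y hy z hz hyz
    have h1 := e.injOn (h hy.2) (h hz.2) hyz
    exact e'.symm.injOn hy.1 hz.1 h1

/-- On the domain of a chart the Riemannian volume is the measure of the chart. -/
lemma riemannianVolume_restrict_source (he : e ∈ atlas Plane M) :
    (riemannianVolume M).restrict e.source = chartVolume e := by
  have hself : (chartVolume e).restrict e.source = chartVolume e := by
    refine Measure.restrict_eq_self_of_ae_mem ?_
    exact chartVolume_compl_source e
  have hle : ∀ e' ∈ atlas Plane M, (chartVolume e').restrict e.source ≤ chartVolume e := by
    intro e' he'
    refine Measure.le_iff.2 fun A hA => ?_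
    rw [Measure.restrict_apply hA]
    have h1 : chartVolume e' (A ∩ e.source) = chartVolume e' (A ∩ e.source ∩ e'.source) := by
      refine (measure_inter_conull' ?_).symm
      refine measure_mono_null ?_ (chartVolume_compl_source e')
      exact fun x hx => hx.2
    rw [h1, chartVolume_eq_of_subset he he'
      ((hA.inter e.open_source.measurableSet).inter e'.open_source.measurableSet)
      (fun x hx => hx.1.2) (fun x hx => hx.2)]
    exact measure_mono fun x hx => hx.1.1
  -- A measure that dominates every chart measure: infinite off `e.source`, `chartVolume e` on it.
  let κ : Measure M := chartVolume e + ((⊤ : ℝ≥0∞) • Measure.count).restrict e.sourceᶜ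
  have hκ : riemannianVolume M ≤ κ := by
    refine iSup_le fun e' => Measure.le_iff.2 fun A hA => ?_
    by_cases hAe : A ⊆ e.source
    · have h1 := hle e' e'.2 A
      rw [Measure.restrict_apply hA, inter_eq_left.2 hAe] at h1
      exact h1.trans (by simp [κ])
    · obtain ⟨x, hxA, hxe⟩ := not_subset.1 hAe
      have h2 : ((⊤ : ℝ≥0∞) • Measure.count).restrict e.sourceᶜ A = ⊤ := by
        rw [Measure.restrict_apply hA, Measure.smul_apply, smul_eq_mul]
        refine ENNReal.top_mul fun h0 => ?_
        rw [Measure.count_eq_zero_iff] at h0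
        exact notMem_empty x (h0 ▸ ⟨hxA, hxe⟩)
      have h3 : κ A = ⊤ := by simp only [κ, Measure.add_apply, h2, add_top]
      exact h3 ▸ le_top
  apply le_antisymm
  · refine (Measure.restrict_mono le_rfl hκ).trans ?_
    rw [Measure.restrict_add, hself, Measure.restrict_restrict e.open_source.measurableSet,
      inter_compl_self, Measure.restrict_empty, add_zero]
  · rw [← hself]
    exact Measure.restrict_mono le_rfl (le_iSup (fun e : atlas Plane M =>
      chartVolume (e : OpenPartialHomeomorph M Plane)) ⟨e, he⟩)

lemma riemannianVolume_apply (he : e ∈ atlas Plane M) {A : Set M} (hA : MeasurableSet A)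
    (h : A ⊆ e.source) : riemannianVolume M A = ∫⁻ y in e.target ∩ e.symm ⁻¹' A,
      ENNReal.ofReal (Real.sqrt (gramMatrix e y).det) := by
  rw [← chartVolume_apply e hA, ← riemannianVolume_restrict_source he, Measure.restrict_apply hA,
    inter_eq_left.2 h]

/-- A property which holds almost everywhere in the coordinates of a chart holds almost everywhere
on its domain. -/
lemma ae_restrict_source_of_ae_target (he : e ∈ atlas Plane M) {P : M → Prop}
    (h : ∀ᵐ y ∂((volume : Measure Plane).restrict e.target), P (e.symm y)) :
    ∀ᵐ x ∂((riemannianVolume M).restrict e.source), P x := by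
  rw [riemannianVolume_restrict_source he]
  rw [ae_restrict_iff' e.open_target.measurableSet] at h
  obtain ⟨N, hN, hNm, hN0⟩ := exists_measurable_superset_of_null h
  have hsub : {x | ¬ P x} ⊆ e.sourceᶜ ∪ (e.source ∩ e ⁻¹' N) := by
    intro x hx
    by_cases hxs : x ∈ e.source
    · refine Or.inr ⟨hxs, hN ?_⟩
      simpa [e.map_source hxs, e.left_inv hxs] using hx
    · exact Or.inl hxs
  refine measure_mono_null hsub (measure_union_null (chartVolume_compl_source e) ?_)
  rw [chartVolume_apply e (measurableSet_source_inter e hNm)]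
  refine setLIntegral_measure_zero _ _ (measure_mono_null ?_ hN0)
  intro y hy
  simpa [e.right_inv hy.1] using hy.2.2

lemma ae_of_ae_target [CompactSpace M] {P : M → Prop}
    (h : ∀ e ∈ atlas Plane M, ∀ᵐ y ∂((volume : Measure Plane).restrict e.target), P (e.symm y)) :
    ∀ᵐ x ∂(riemannianVolume M), P x := by
  obtain ⟨s, -, hs⟩ := isCompact_univ.elim_nhds_subcover (fun x : M => (chartAt Plane x).source)
    (fun x _ => (chartAt Plane x).open_source.mem_nhds (mem_chart_source Plane x))
  rw [← Measure.restrict_univ (μ := riemannianVolume M), ← univ_subset_iff.1 hs]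
  rw [ae_restrict_biUnion_finset_iff]
  exact fun x _ => ae_restrict_source_of_ae_target (chart_mem_atlas _ _) (h _ (chart_mem_atlas _ _))

end Volume

/-! ### The Riemannian distance in charts -/

section Distance

variable {M : Type*} [MetricSpace M] [ChartedSpace Plane M] {e : OpenPartialHomeomorph M Plane}
  [RiemannianBundle (fun x : M => TangentSpace (𝓡 2) x)]

lemma norm_sq_coordVec (e : OpenPartialHomeomorph M Plane) (y v : Plane) :
    ‖coordVec e y v‖ ^ 2 = gramMatrix e y 0 0 * v 0 ^ 2 + 2 * gramMatrix e y 0 1 * (v 0 * v 1)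
      + gramMatrix e y 1 1 * v 1 ^ 2 := by
  conv_lhs => rw [plane_eq_sum v]
  rw [← real_inner_self_eq_norm_sq]
  simp only [coordVec_add, coordVec_smul, gramMatrix, Matrix.of_apply, inner_add_left,
    inner_add_right, real_inner_smul_left, real_inner_smul_right]
  rw [real_inner_comm (coordVec e y (EuclideanSpace.single 0 1))
    (coordVec e y (EuclideanSpace.single 1 1))]
  ring

variable [IsManifold (𝓡 2) 1 M]

lemma norm_coordVec_mfderiv (he : e ∈ atlas Plane M) {x : M} (hx : x ∈ e.source)
    (w : TangentSpace (𝓡 2) x) :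
    ‖coordVec e (e x) (mfderiv (𝓡 2) (𝓡 2) e x w)‖ = ‖w‖ := by
  have h := (mdifferentiable_chart he).symm_comp_deriv hx
  have h1 : (coordVec e (e x) (mfderiv (𝓡 2) (𝓡 2) e x w) : Plane) = w :=
    congrArg (fun L : Plane →L[ℝ] Plane => L w) h
  rw [norm_eq_sqrt_real_inner, norm_eq_sqrt_real_inner]
  congr 1
  have h2 := inner_tangent_congr (e.left_inv hx)
    (coordVec e (e x) (mfderiv (𝓡 2) (𝓡 2) e x w)) (coordVec e (e x) (mfderiv (𝓡 2) (𝓡 2) e x w))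
  refine h2.trans ?_
  rw [h1]

section Length

variable [IsRiemannianManifold (𝓡 2) M]

/-- If the metric is bounded by `c ‖A ·‖` in a ball of a chart, then the distance is bounded by
the length of the coordinate segment. -/
lemma dist_symm_le (he : e ∈ atlas Plane M) {y₀ : Plane} {r c : ℝ} (hc : 0 ≤ c)
    {A : Plane ≃L[ℝ] Plane} (hr : Metric.ball y₀ r ⊆ e.target)
    (hA : ∀ y ∈ Metric.ball y₀ r, ∀ v, ‖coordVec e y v‖ ≤ c * ‖A v‖) {y y' : Plane}
    (hy : y ∈ Metric.ball y₀ r) (hy' : y' ∈ Metric.ball y₀ r) :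
    dist (e.symm y) (e.symm y') ≤ c * ‖A (y' - y)‖ := by
  let η : ℝ →ᴬ[ℝ] Plane := ContinuousAffineMap.lineMap (R := ℝ) y y'
  have hη : ∀ t ∈ Icc (0 : ℝ) 1, η t ∈ Metric.ball y₀ r := by
    intro t ht
    apply (convex_ball y₀ r).segment_subset hy hy'
    rw [segment_eq_image_lineMap]
    exact ⟨t, ht, rfl⟩
  have hη' : MapsTo η (Icc 0 1) e.target := fun t ht => hr (hη t ht)
  have η_smooth : ContMDiffOn 𝓘(ℝ, ℝ) (𝓡 2) 1 η (Icc 0 1) := by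
    apply ContMDiff.contMDiffOn
    rw [contMDiff_iff_contDiff]
    exact ContinuousAffineMap.contDiff _
  have hsymm : ContMDiffOn (𝓡 2) (𝓡 2) 1 e.symm e.target := contMDiffOn_symm_of_mem_maximalAtlas
    (IsManifold.subset_maximalAtlas he)
  have h1 : edist (e.symm y) (e.symm y') ≤ Manifold.pathELength (𝓡 2) (e.symm ∘ η) 0 1 := by
    rw [IsRiemannianManifold.out (I := 𝓡 2)]
    apply Manifold.riemannianEDist_le_pathELength _ _ _ zero_le_one
    · exact hsymm.comp η_smooth hη'
    · simp [η, ContinuousAffineMap.coe_lineMap_eq]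
    · simp [η, ContinuousAffineMap.coe_lineMap_eq]
  have h2 : Manifold.pathELength (𝓡 2) (e.symm ∘ η) 0 1 ≤ ENNReal.ofReal (c * ‖A (y' - y)‖) := by
    rw [Manifold.pathELength_eq_lintegral_mfderivWithin_Icc]
    calc _ ≤ ∫⁻ t in Icc (0 : ℝ) 1, ENNReal.ofReal (c * ‖A (y' - y)‖) := by
          apply setLIntegral_mono' measurableSet_Icc (fun t ht ↦ ?_)
          have huniq : UniqueMDiffWithinAt 𝓘(ℝ, ℝ) (Icc (0 : ℝ) 1) t := by
            rw [uniqueMDiffWithinAt_iff_uniqueDiffWithinAt]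
            exact uniqueDiffOn_Icc zero_lt_one t ht
          have h3 : mfderivWithin 𝓘(ℝ, ℝ) (𝓡 2) (e.symm ∘ η) (Icc 0 1) t =
              (mfderiv (𝓡 2) (𝓡 2) e.symm (η t)) ∘L
                (mfderivWithin 𝓘(ℝ, ℝ) (𝓡 2) η (Icc 0 1) t) := by
            apply mfderiv_comp_mfderivWithin
            · exact mdifferentiableAt_atlas_symm he (hη' ht)
            · exact η_smooth.mdifferentiableOn one_ne_zero t ht
            · exact huniq
          have h4 : mfderivWithin 𝓘(ℝ, ℝ) (𝓡 2) η (Icc 0 1) t 1 = y' - y := by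
            rw [mfderivWithin_eq_fderivWithin]
            have : HasDerivAt (fun t : ℝ => η t) (y' - y) t := by
              have := AffineMap.hasDerivAt_lineMap (a := y) (b := y') (x := t)
              exact this
            have h5 := this.hasDerivWithinAt (s := Icc (0 : ℝ) 1)
            have h6 := h5.derivWithin (uniqueDiffOn_Icc zero_lt_one t ht)
            rw [← fderivWithin_derivWithin] at h6
            exact h6
          have h7 : (mfderivWithin 𝓘(ℝ, ℝ) (𝓡 2) (e.symm ∘ η) (Icc 0 1) t 1)
              = coordVec e (η t) (y' - y) := by
            have := congrArg (fun L : ℝ →L[ℝ] Plane => L 1) h3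
            refine this.trans ?_
            rw [← h4]
            rfl
          rw [h7, ← ofReal_norm]
          exact ENNReal.ofReal_le_ofReal (hA _ (hη t ht) _)
      _ = ENNReal.ofReal (c * ‖A (y' - y)‖) := by simp
  have h3 := h1.trans h2
  rw [edist_dist] at h3
  exact (ENNReal.ofReal_le_ofReal_iff (by positivity)).1 h3

/-- If the metric is bounded below by `‖A ·‖ / c` in a set of a chart containing a metric ball,
then so is the distance to the centre in this ball. -/
lemma norm_sub_le_dist (he : e ∈ atlas Plane M) {B : Set Plane} {ρ c : ℝ} (hc : 0 ≤ c)
    {A : Plane ≃L[ℝ] Plane} {z : M}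
    (hA : ∀ y ∈ B, ∀ v, ‖A v‖ ≤ c * ‖coordVec e y v‖)
    (hz : Metric.ball z ρ ⊆ e.source ∩ e ⁻¹' B) {x : M} (hx : x ∈ Metric.ball z ρ) :
    ‖A (e x - e z)‖ ≤ c * dist x z := by
  suffices H : ∀ s, dist x z < s → s < ρ → ‖A (e x - e z)‖ ≤ c * s by
    have hlim : Tendsto (fun s => c * s) (nhdsWithin (dist x z) (Ioi (dist x z)))
        (nhds (c * dist x z)) :=
      (tendsto_id.const_mul c).mono_left nhdsWithin_le_nhds
    refine ge_of_tendsto hlim ?_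
    filter_upwards [Ioo_mem_nhdsGT (Metric.mem_ball.1 hx)] with s hs using H s hs.1 hs.2
  intro s hs hsρ
  have hs0 : 0 ≤ s := dist_nonneg.trans hs.le
  have hlt : Manifold.riemannianEDist (𝓡 2) z x < ENNReal.ofReal s := by
    rw [← IsRiemannianManifold.out (I := 𝓡 2), edist_dist, dist_comm]
    exact (ENNReal.ofReal_lt_ofReal_iff_of_nonneg dist_nonneg).2 hs
  obtain ⟨γ, hγ0, hγ1, hγ, hlen⟩ := Manifold.exists_lt_of_riemannianEDist_lt hlt
  have hin : ∀ t ∈ Icc (0 : ℝ) 1, γ t ∈ Metric.ball z ρ := by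
    intro t ht
    have h1 : edist z (γ t) ≤ Manifold.pathELength (𝓡 2) γ 0 t := by
      rw [IsRiemannianManifold.out (I := 𝓡 2)]
      exact Manifold.riemannianEDist_le_pathELength (hγ.mono (Icc_subset_Icc_right ht.2)) hγ0 rfl
        ht.1
    have h2 : edist z (γ t) < ENNReal.ofReal s :=
      (h1.trans (Manifold.pathELength_mono le_rfl ht.2)).trans_lt hlen
    rw [edist_dist, ENNReal.ofReal_lt_ofReal_iff_of_nonneg dist_nonneg] at h2
    rw [Metric.mem_ball, dist_comm]
    exact h2.trans hsρ
  have hchart : ContMDiffOn (𝓡 2) (𝓡 2) 1 e e.source := contMDiffOn_of_mem_maximalAtlas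
    (IsManifold.subset_maximalAtlas he)
  have heγ : ContMDiffOn 𝓘(ℝ, ℝ) (𝓡 2) 1 (e ∘ γ) (Icc 0 1) :=
    hchart.comp hγ fun t ht => (hz (hin t ht)).1
  have heγ' : ContDiffOn ℝ 1 (e ∘ γ) (Icc 0 1) := contMDiffOn_iff_contDiffOn.1 heγ
  have hAeγ : ContDiffOn ℝ 1 (fun t => A (e (γ t))) (Icc 0 1) := A.contDiff.comp_contDiffOn heγ'
  have h1 : ‖A (e (γ 1)) - A (e (γ 0))‖ₑ ≤ ∫⁻ t in Icc (0 : ℝ) 1,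
      ‖derivWithin (fun t => A (e (γ t))) (Icc 0 1) t‖ₑ :=
    enorm_sub_le_lintegral_derivWithin_Icc_of_contDiffOn_Icc hAeγ zero_le_one
  have h2 : ∫⁻ t in Icc (0 : ℝ) 1, ‖derivWithin (fun t => A (e (γ t))) (Icc 0 1) t‖ₑ
      ≤ ∫⁻ t in Icc (0 : ℝ) 1, ENNReal.ofReal c *
        ‖mfderivWithin 𝓘(ℝ, ℝ) (𝓡 2) γ (Icc 0 1) t 1‖ₑ := by
    apply setLIntegral_mono' measurableSet_Icc (fun t ht ↦ ?_)
    have hu : UniqueDiffWithinAt ℝ (Icc (0 : ℝ) 1) t := uniqueDiffOn_Icc zero_lt_one t ht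
    have hsrc := (hz (hin t ht)).1
    have h3 : mfderivWithin 𝓘(ℝ, ℝ) (𝓡 2) (e ∘ γ) (Icc 0 1) t =
        (mfderiv (𝓡 2) (𝓡 2) e (γ t)) ∘L (mfderivWithin 𝓘(ℝ, ℝ) (𝓡 2) γ (Icc 0 1) t) := by
      apply mfderiv_comp_mfderivWithin
      · exact mdifferentiableAt_atlas he hsrc
      · exact hγ.mdifferentiableOn one_ne_zero t ht
      · rwa [uniqueMDiffWithinAt_iff_uniqueDiffWithinAt]
    have h4 : derivWithin (e ∘ γ) (Icc 0 1) t = mfderiv (𝓡 2) (𝓡 2) e (γ t)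
        (mfderivWithin 𝓘(ℝ, ℝ) (𝓡 2) γ (Icc 0 1) t 1) := by
      rw [← fderivWithin_derivWithin, ← mfderivWithin_eq_fderivWithin]
      exact congrArg (fun L : ℝ →L[ℝ] Plane => L 1) h3
    have h5 : derivWithin (fun t => A (e (γ t))) (Icc 0 1) t
        = A (derivWithin (e ∘ γ) (Icc 0 1) t) :=
      ((A : Plane →L[ℝ] Plane).hasFDerivAt.comp_hasDerivWithinAt t
        ((heγ'.differentiableOn one_ne_zero) t ht).hasDerivWithinAt).derivWithin hu
    rw [h5, h4, ← ofReal_norm, ← ofReal_norm, ← ENNReal.ofReal_mul hc]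
    refine ENNReal.ofReal_le_ofReal ((hA _ (hz (hin t ht)).2 _).trans ?_)
    rw [norm_coordVec_mfderiv he hsrc]
  have h3 : ‖A (e x - e z)‖ₑ ≤ ENNReal.ofReal (c * s) := by
    rw [map_sub, ← hγ0, ← hγ1]
    refine (h1.trans h2).trans ?_
    rw [lintegral_const_mul' _ _ ENNReal.ofReal_ne_top,
      ← Manifold.pathELength_eq_lintegral_mfderivWithin_Icc, ENNReal.ofReal_mul hc]
    gcongr
  rw [← ofReal_norm] at h3
  exact (ENNReal.ofReal_le_ofReal_iff (by positivity)).1 h3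

end Length

variable [IsContinuousRiemannianBundle Plane (fun x : M => TangentSpace (𝓡 2) x)]

lemma continuousOn_gramMatrix (he : e ∈ atlas Plane M) (i j : Fin 2) :
    ContinuousOn (fun y => gramMatrix e y i j) e.target := by
  simp only [gramMatrix, Matrix.of_apply]
  exact continuousOn_inner_coordVec he _ _

/-- Near a point `y₀`, the metric in a chart is comparable to the constant metric at `y₀`, with a
constant arbitrarily close to `1`. -/
lemma exists_ball_norm_coordVec_le (he : e ∈ atlas Plane M) {y₀ : Plane} (hy₀ : y₀ ∈ e.target)
    {c : ℝ} (hc : 1 < c) :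
    ∃ A : Plane ≃L[ℝ] Plane, (∀ v, ‖A v‖ = ‖coordVec e y₀ v‖) ∧ ∃ r > 0,
      Metric.ball y₀ r ⊆ e.target ∧ ∀ y ∈ Metric.ball y₀ r,
        (∀ v, ‖coordVec e y v‖ ≤ c * ‖A v‖) ∧ (∀ v, ‖A v‖ ≤ c * ‖coordVec e y v‖) ∧
        Real.sqrt (gramMatrix e y).det ≤ c * |(A : Plane →L[ℝ] Plane).det| ∧
        |(A : Plane →L[ℝ] Plane).det| ≤ c * Real.sqrt (gramMatrix e y).det := by
  obtain ⟨A, hA⟩ := exists_normEquiv (coordEquiv he hy₀)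
  have hA' : ∀ v, ‖A v‖ = ‖coordVec e y₀ v‖ := fun v => by rw [hA v, coordEquiv_apply]
  refine ⟨A, hA', ?_⟩
  have hdet : (gramMatrix e y₀).det = (A : Plane →L[ℝ] Plane).det ^ 2 :=
    det_gram_eq_sq (coordLinear e y₀) A hA'
  have hsqrt : Real.sqrt (gramMatrix e y₀).det = |(A : Plane →L[ℝ] Plane).det| := by
    rw [hdet, Real.sqrt_sq_eq_abs]
  have hpos : 0 < |(A : Plane →L[ℝ] Plane).det| :=
    abs_pos.2 (LinearEquiv.isUnit_det' A.toLinearEquiv).ne_zero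
  have htgt := e.open_target.mem_nhds hy₀
  set C : ℝ := ‖(A.symm : Plane →L[ℝ] Plane)‖ ^ 2 with hC
  have hC0 : 0 ≤ C := sq_nonneg _
  have hAv : ∀ v, ‖v‖ ^ 2 ≤ C * ‖A v‖ ^ 2 := by
    intro v
    have := (A.symm : Plane →L[ℝ] Plane).le_opNorm (A v)
    simp only [ContinuousLinearEquiv.coe_coe, ContinuousLinearEquiv.symm_apply_apply] at this
    rw [hC, ← mul_pow]
    gcongr
  obtain ⟨η, hη0, hη⟩ : ∃ η : ℝ, 0 < η ∧ c ^ 2 * (1 - η) = 1 := by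
    refine ⟨1 - (c ^ 2)⁻¹, ?_, ?_⟩
    · have : (c ^ 2)⁻¹ < 1 := inv_lt_one_of_one_lt₀ (by nlinarith)
      linarith
    · field_simp
      ring
  have hη2 : 1 + η ≤ c ^ 2 := by
    have h1 : 0 < 1 - η := pos_of_mul_pos_right (by rw [hη]; exact zero_lt_one) (sq_nonneg c)
    refine le_of_mul_le_mul_right ?_ h1
    nlinarith
  obtain ⟨δ, hδ0, hδ⟩ : ∃ δ : ℝ, 0 < δ ∧ 2 * δ * C ≤ η := by
    refine ⟨η / (2 * (C + 1)), by positivity, ?_⟩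
    rw [show 2 * (η / (2 * (C + 1))) * C = η * (C / (C + 1)) by field_simp]
    refine mul_le_of_le_one_right hη0.le ?_
    rw [div_le_one (by positivity)]
    linarith
  have hev : ∀ᶠ y in nhds y₀, y ∈ e.target ∧
      (∀ i j, |gramMatrix e y i j - gramMatrix e y₀ i j| < δ) ∧
      Real.sqrt (gramMatrix e y).det < c * |(A : Plane →L[ℝ] Plane).det| ∧
      c⁻¹ * |(A : Plane →L[ℝ] Plane).det| < Real.sqrt (gramMatrix e y).det := by
    have hs : ContinuousAt (fun y => Real.sqrt (gramMatrix e y).det) y₀ :=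
      ((continuousOn_det_gramMatrix he).continuousAt htgt).sqrt
    refine (eventually_of_mem htgt fun y hy => hy).and (.and ?_ (.and ?_ ?_))
    · refine eventually_all.2 fun i => eventually_all.2 fun j => ?_
      have := ((continuousOn_gramMatrix he i j).continuousAt htgt)
      rw [Metric.continuousAt_iff'] at this
      simpa [Real.dist_eq] using this δ hδ0
    · refine hs.eventually_lt_const ?_
      simp only [hsqrt]
      nlinarith
    · refine hs.eventually_const_lt ?_
      simp only [hsqrt]
      exact mul_lt_of_lt_one_left hpos (inv_lt_one_of_one_lt₀ hc)
  obtain ⟨r, hr, hball⟩ := Metric.mem_nhds_iff.1 hev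
  have hc0 : 0 < c := by linarith
  refine ⟨r, hr, fun y hy => (hball hy).1, fun y hy => ?_⟩
  obtain ⟨-, hG, hd1, hd2⟩ := hball hy
  have hclose : ∀ v, |‖coordVec e y v‖ ^ 2 - ‖A v‖ ^ 2| ≤ η * ‖A v‖ ^ 2 := by
    intro v
    have h1 : |‖coordVec e y v‖ ^ 2 - ‖A v‖ ^ 2| ≤ 2 * δ * ‖v‖ ^ 2 := by
      rw [hA' v, norm_sq_coordVec, norm_sq_coordVec, EuclideanSpace.real_norm_sq_eq,
        Fin.sum_univ_two]
      have h00 := abs_lt.1 (hG 0 0)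
      have h01 := abs_lt.1 (hG 0 1)
      have h11 := abs_lt.1 (hG 1 1)
      have hcross : |2 * (gramMatrix e y 0 1 - gramMatrix e y₀ 0 1) * (v 0 * v 1)|
          ≤ δ * (v 0 ^ 2 + v 1 ^ 2) := by
        rw [abs_mul, abs_mul, abs_two]
        have : 2 * |v 0 * v 1| ≤ v 0 ^ 2 + v 1 ^ 2 := by
          rw [abs_mul, ← sq_abs (v 0), ← sq_abs (v 1)]
          nlinarith [sq_nonneg (|v 0| - |v 1|)]
        nlinarith [hG 0 1, abs_nonneg (v 0 * v 1)]
      have hcr := abs_le.1 hcross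
      rw [abs_le]
      constructor <;> nlinarith [sq_nonneg (v 0), sq_nonneg (v 1)]
    calc _ ≤ 2 * δ * ‖v‖ ^ 2 := h1
      _ ≤ 2 * δ * (C * ‖A v‖ ^ 2) := by gcongr; exact hAv v
      _ = (2 * δ * C) * ‖A v‖ ^ 2 := by ring
      _ ≤ η * ‖A v‖ ^ 2 := by gcongr
  refine ⟨fun v => ?_, fun v => ?_, hd1.le, ?_⟩
  · refine le_of_sq_le_sq ?_ (by positivity)
    have := (abs_le.1 (hclose v)).2
    rw [mul_pow]
    nlinarith [sq_nonneg ‖A v‖]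
  · refine le_of_sq_le_sq ?_ (by positivity)
    have := (abs_le.1 (hclose v)).1
    rw [mul_pow]
    nlinarith [sq_nonneg ‖A v‖, sq_nonneg c]
  · rw [inv_mul_lt_iff₀ hc0] at hd2
    exact hd2.le

end Distance

/-! ### Areas of small balls -/

section BallVolume

variable {M : Type*} [MetricSpace M] [ChartedSpace Plane M] [IsManifold (𝓡 2) 1 M]
  [RiemannianBundle (fun x : M => TangentSpace (𝓡 2) x)]
  [IsContinuousRiemannianBundle Plane (fun x : M => TangentSpace (𝓡 2) x)]
  [IsRiemannianManifold (𝓡 2) M] [MeasurableSpace M] [BorelSpace M]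

lemma volume_preimage_ball (A : Plane ≃L[ℝ] Plane) (w : Plane) {s : ℝ} (hs : 0 ≤ s) :
    (volume : Measure Plane) (A ⁻¹' Metric.ball w s)
      = ENNReal.ofReal (|(A : Plane →L[ℝ] Plane).det|⁻¹ * (Real.pi * s ^ 2)) := by
  have hdet : LinearMap.det ((A : Plane →L[ℝ] Plane) : Plane →ₗ[ℝ] Plane) ≠ 0 :=
    (LinearEquiv.isUnit_det' A.toLinearEquiv).ne_zero
  have h := Measure.addHaar_preimage_continuousLinearMap (volume : Measure Plane)
    (f := (A : Plane →L[ℝ] Plane)) hdet (Metric.ball w s)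
  refine h.trans ?_
  rw [EuclideanSpace.volume_ball_fin_two, ← ENNReal.ofReal_pow hs,
    ← ENNReal.ofReal_mul (by positivity), ← ENNReal.ofReal_mul (by positivity), abs_inv]
  congr 1
  rw [ContinuousLinearMap.det]
  ring

/-- Small balls centred near a given point have almost the area of Euclidean discs. -/
lemma exists_volume_ball_local (z₀ : M) {c : ℝ} (hc : 1 < c) :
    ∃ ρ > 0, ∀ z ∈ Metric.ball z₀ ρ, ∀ s, 0 < s → s < ρ →
      riemannianVolume M (Metric.ball z s) ≤ ENNReal.ofReal (c ^ 3 * Real.pi * s ^ 2) ∧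
      ENNReal.ofReal ((c ^ 3)⁻¹ * Real.pi * s ^ 2) ≤ riemannianVolume M (Metric.ball z s) := by
  have he := chart_mem_atlas Plane z₀
  set e := chartAt Plane z₀
  have hz₀ : z₀ ∈ e.source := mem_chart_source Plane z₀
  obtain ⟨A, -, r, hr, hrt, hcomp⟩ := exists_ball_norm_coordVec_le he (e.map_source hz₀) hc
  set D := |(A : Plane →L[ℝ] Plane).det| with hD
  have hDpos : 0 < D := abs_pos.2 (LinearEquiv.isUnit_det' A.toLinearEquiv).ne_zero
  have hc0 : 0 < c := by linarith
  have hnhds : e.source ∩ e ⁻¹' Metric.ball (e z₀) (r / 2) ∈ nhds z₀ :=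
    inter_mem (e.open_source.mem_nhds hz₀)
      ((e.continuousAt hz₀).preimage_mem_nhds (Metric.ball_mem_nhds _ (by positivity)))
  obtain ⟨R, hR, hRsub⟩ := Metric.mem_nhds_iff.1 hnhds
  set C := ‖(A.symm : Plane →L[ℝ] Plane)‖
  have hC0 : 0 ≤ C := norm_nonneg _
  refine ⟨min (R / 2) (r / (2 * (C + 1))), by positivity, fun z hz s hs hsρ => ?_⟩
  have hsR : s < R / 2 := hsρ.trans_le (min_le_left _ _)
  have hsr : C * s < r / 2 := by
    have h1 : s < r / (2 * (C + 1)) := hsρ.trans_le (min_le_right _ _)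
    rw [lt_div_iff₀ (by positivity)] at h1
    nlinarith
  have hzR : dist z z₀ < R / 2 := (Metric.mem_ball.1 hz).trans_le (min_le_left _ _)
  have hsub : Metric.ball z s ⊆ Metric.ball z₀ R := Metric.ball_subset_ball' (by linarith)
  have hsub' : Metric.ball z s ⊆ e.source := fun x hx => (hRsub (hsub hx)).1
  have hhalf : Metric.ball (e z₀) (r / 2) ⊆ Metric.ball (e z₀) r :=
    Metric.ball_subset_ball (by linarith)
  have hzsrc : z ∈ e.source := hsub' (Metric.mem_ball_self hs)
  have hzball : e z ∈ Metric.ball (e z₀) (r / 2) := (hRsub (hsub (Metric.mem_ball_self hs))).2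
  rw [riemannianVolume_apply he Metric.isOpen_ball.measurableSet hsub']
  have hmeas := measurableSet_target_inter e (Metric.isOpen_ball (x := z) (ε := s)).measurableSet
  have hin : ∀ y ∈ e.target ∩ e.symm ⁻¹' Metric.ball z s, y ∈ Metric.ball (e z₀) r := by
    intro y hy
    have := hhalf (hRsub (hsub hy.2)).2
    rwa [e.right_inv hy.1] at this
  constructor
  · have hS : e.target ∩ e.symm ⁻¹' Metric.ball z s ⊆ A ⁻¹' Metric.ball (A (e z)) (c * s) := by
      intro y hy
      have h1 := norm_sub_le_dist he hc0.le (fun y hy => (hcomp y hy).2.1)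
        (z := z) (ρ := s) (fun x hx => ⟨hsub' hx, hhalf (hRsub (hsub hx)).2⟩) hy.2
      rw [e.right_inv hy.1] at h1
      rw [mem_preimage, Metric.mem_ball, dist_eq_norm, ← map_sub]
      refine h1.trans_lt ?_
      gcongr
      exact hy.2
    calc _ ≤ ∫⁻ y in e.target ∩ e.symm ⁻¹' Metric.ball z s, ENNReal.ofReal (c * D) :=
          setLIntegral_mono' hmeas fun y hy =>
            ENNReal.ofReal_le_ofReal (hcomp y (hin y hy)).2.2.1
      _ = ENNReal.ofReal (c * D) * volume (e.target ∩ e.symm ⁻¹' Metric.ball z s) :=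
          setLIntegral_const _ _
      _ ≤ ENNReal.ofReal (c * D) * volume (A ⁻¹' Metric.ball (A (e z)) (c * s)) := by
          gcongr
      _ = ENNReal.ofReal (c ^ 3 * Real.pi * s ^ 2) := by
          rw [volume_preimage_ball A _ (by positivity), ← hD, ← ENNReal.ofReal_mul (by positivity)]
          congr 1
          field_simp
  · have hS : A ⁻¹' Metric.ball (A (e z)) (s / c) ⊆ e.target ∩ e.symm ⁻¹' Metric.ball z s := by
      intro y hy
      rw [mem_preimage, Metric.mem_ball, dist_eq_norm, ← map_sub] at hy
      have hsc : s / c ≤ s := div_le_self hs.le hc.le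
      have h1 : ‖y - e z‖ ≤ C * ‖A (y - e z)‖ := by
        have := (A.symm : Plane →L[ℝ] Plane).le_opNorm (A (y - e z))
        simpa using this
      have h2 : y ∈ Metric.ball (e z₀) r := by
        rw [Metric.mem_ball] at hzball ⊢
        have h3 : dist y (e z) < r / 2 := by
          rw [dist_eq_norm]
          refine (h1.trans ?_).trans_lt hsr
          gcongr
          exact hy.le.trans hsc
        linarith [dist_triangle y (e z) (e z₀)]
      refine ⟨hrt h2, ?_⟩
      have h4 := dist_symm_le he hc0.le hrt (fun y hy => (hcomp y hy).1) (hhalf hzball) h2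
      rw [e.left_inv hzsrc, dist_comm] at h4
      rw [mem_preimage, Metric.mem_ball]
      refine h4.trans_lt ?_
      rwa [lt_div_iff₀' hc0] at hy
    calc ENNReal.ofReal ((c ^ 3)⁻¹ * Real.pi * s ^ 2)
        = ENNReal.ofReal (c⁻¹ * D) * volume (A ⁻¹' Metric.ball (A (e z)) (s / c)) := by
          rw [volume_preimage_ball A _ (by positivity), ← hD, ← ENNReal.ofReal_mul (by positivity)]
          congr 1
          field_simp
      _ ≤ ENNReal.ofReal (c⁻¹ * D) * volume (e.target ∩ e.symm ⁻¹' Metric.ball z s) := by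
          gcongr
      _ = ∫⁻ y in e.target ∩ e.symm ⁻¹' Metric.ball z s, ENNReal.ofReal (c⁻¹ * D) :=
          (setLIntegral_const _ _).symm
      _ ≤ _ := setLIntegral_mono' hmeas fun y hy => by
          refine ENNReal.ofReal_le_ofReal ?_
          rw [inv_mul_le_iff₀ hc0]
          exact (hcomp y (hin y hy)).2.2.2

/-- On a compact surface small balls have almost the area of Euclidean discs, uniformly. -/
lemma exists_volume_ball [CompactSpace M] {c : ℝ} (hc : 1 < c) :
    ∃ ρ > 0, ∀ z : M, ∀ s, 0 < s → s < ρ →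
      riemannianVolume M (Metric.ball z s) ≤ ENNReal.ofReal (c ^ 3 * Real.pi * s ^ 2) ∧
      ENNReal.ofReal ((c ^ 3)⁻¹ * Real.pi * s ^ 2) ≤ riemannianVolume M (Metric.ball z s) := by
  have := isCompact_univ.induction_on (X := M) (p := fun S => ∃ ρ > 0, ∀ z ∈ S, ∀ s, 0 < s → s < ρ →
      riemannianVolume M (Metric.ball z s) ≤ ENNReal.ofReal (c ^ 3 * Real.pi * s ^ 2) ∧
      ENNReal.ofReal ((c ^ 3)⁻¹ * Real.pi * s ^ 2) ≤ riemannianVolume M (Metric.ball z s))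
    ⟨1, one_pos, by simp⟩
    (fun S T hST ⟨ρ, hρ, h⟩ => ⟨ρ, hρ, fun z hz => h z (hST hz)⟩)
    (fun S T ⟨ρ, hρ, h⟩ ⟨ρ', hρ', h'⟩ => ⟨min ρ ρ', lt_min hρ hρ', fun z hz s hs hs' =>
      hz.elim (fun hz => h z hz s hs (hs'.trans_le (min_le_left _ _)))
        (fun hz => h' z hz s hs (hs'.trans_le (min_le_right _ _)))⟩)
    (fun z _ => by
      obtain ⟨ρ, hρ, h⟩ := exists_volume_ball_local z hc
      exact ⟨_, mem_nhdsWithin_of_mem_nhds (Metric.ball_mem_nhds z hρ), ρ, hρ, h⟩)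
  simpa using this

end BallVolume

/-! ### Gradients -/

section Gradient

variable {M : Type*} [MetricSpace M] [ChartedSpace Plane M] {e : OpenPartialHomeomorph M Plane}

section Coordinates

variable [IsManifold (𝓡 2) 1 M]

lemma mdifferentiableAt_symm_iff (he : e ∈ atlas Plane M) {y : Plane} (hy : y ∈ e.target)
    (u : M → ℝ) : MDifferentiableAt (𝓡 2) 𝓘(ℝ, ℝ) u (e.symm y) ↔
      DifferentiableAt ℝ (fun y => u (e.symm y)) y := by
  constructor
  · intro h
    exact mdifferentiableAt_iff_differentiableAt.1 (h.comp y (mdifferentiableAt_atlas_symm he hy))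
  · intro h
    have h1 : MDifferentiableAt (𝓡 2) 𝓘(ℝ, ℝ) (fun y => u (e.symm y)) (e (e.symm y)) := by
      rw [e.right_inv hy]
      exact h.mdifferentiableAt
    have h2 := h1.comp (e.symm y) (mdifferentiableAt_atlas he (e.map_target hy))
    refine h2.congr_of_eventuallyEq ?_
    filter_upwards [e.open_source.mem_nhds (e.map_target hy)] with x hx
    simp [e.left_inv hx]

lemma exists_coordVec_eq (he : e ∈ atlas Plane M) {y : Plane} (hy : y ∈ e.target)
    (w : TangentSpace (𝓡 2) (e.symm y)) : ∃ v, coordVec e y v = w :=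
  ⟨(coordEquiv he hy).symm w, (coordEquiv he hy).apply_symm_apply w⟩

end Coordinates

variable [RiemannianBundle (fun x : M => TangentSpace (𝓡 2) x)]

instance (x : M) : FiniteDimensional ℝ (TangentSpace (𝓡 2) x) :=
  inferInstanceAs (FiniteDimensional ℝ Plane)

instance (x : M) : CompleteSpace (TangentSpace (𝓡 2) x) :=
  FiniteDimensional.complete ℝ _

/-- The gradient of `u`: the vector representing the differential of `u`. It is `0` at the points
where `u` is not differentiable. -/
def gradient (u : M → ℝ) (x : M) : TangentSpace (𝓡 2) x :=
  (InnerProductSpace.toDual ℝ (TangentSpace (𝓡 2) x)).symm (mfderiv (𝓡 2) 𝓘(ℝ, ℝ) u x)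

lemma inner_gradient (u : M → ℝ) (x : M) (w : TangentSpace (𝓡 2) x) :
    (inner ℝ (gradient u x) w : ℝ) = mfderiv (𝓡 2) 𝓘(ℝ, ℝ) u x w :=
  InnerProductSpace.toDual_symm_apply

lemma gradient_add_smul {u v : M → ℝ} {x : M} (hu : MDifferentiableAt (𝓡 2) 𝓘(ℝ, ℝ) u x)
    (hv : MDifferentiableAt (𝓡 2) 𝓘(ℝ, ℝ) v x) (a b : ℝ) :
    gradient (fun x => a * u x + b * v x) x = a • gradient u x + b • gradient v x := by
  have hu' : HasMFDerivAt (𝓡 2) 𝓘(ℝ, ℝ) u x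
    (mfderiv (𝓡 2) 𝓘(ℝ, ℝ) u x : TangentSpace (𝓡 2) x →L[ℝ] ℝ) := hu.hasMFDerivAt
  have hv' : HasMFDerivAt (𝓡 2) 𝓘(ℝ, ℝ) v x
    (mfderiv (𝓡 2) 𝓘(ℝ, ℝ) v x : TangentSpace (𝓡 2) x →L[ℝ] ℝ) := hv.hasMFDerivAt
  have h := ((hu'.const_smul a).add (hv'.const_smul b)).mfderiv
  have hfun : (fun x => a * u x + b * v x) = a • u + b • v := rfl
  refine ext_inner_right ℝ fun w => ?_
  rw [inner_gradient, inner_add_left, real_inner_smul_left, real_inner_smul_left, inner_gradient,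
    inner_gradient, hfun, h]
  rfl

variable [IsManifold (𝓡 2) 1 M]

lemma inner_gradient_coordVec (he : e ∈ atlas Plane M) {y : Plane} (hy : y ∈ e.target)
    (u : M → ℝ) (v : Plane) :
    (inner ℝ (gradient u (e.symm y)) (coordVec e y v) : ℝ)
      = fderiv ℝ (fun y => u (e.symm y)) y v := by
  rw [inner_gradient]
  by_cases h : MDifferentiableAt (𝓡 2) 𝓘(ℝ, ℝ) u (e.symm y)
  · have h1 := mfderiv_comp y h (mdifferentiableAt_atlas_symm he hy)
    rw [← mfderiv_eq_fderiv]
    exact (congrArg (fun L : Plane →L[ℝ] ℝ => L v) h1).symm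
  · rw [mfderiv_zero_of_not_mdifferentiableAt h,
      fderiv_zero_of_not_differentiableAt (mt (mdifferentiableAt_symm_iff he hy u).2 h)]
    rfl

/-- The norm of the gradient in the coordinates of a chart: the inverse Gram matrix applied to the
partial derivatives. -/
lemma norm_gradient_symm (he : e ∈ atlas Plane M) {y : Plane} (hy : y ∈ e.target) (u : M → ℝ) :
    ‖gradient u (e.symm y)‖ = Real.sqrt
      ((gramMatrix e y 1 1 * fderiv ℝ (fun y => u (e.symm y)) y (EuclideanSpace.single 0 1) ^ 2
        - 2 * gramMatrix e y 0 1 * (fderiv ℝ (fun y => u (e.symm y)) y (EuclideanSpace.single 0 1)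
          * fderiv ℝ (fun y => u (e.symm y)) y (EuclideanSpace.single 1 1))
        + gramMatrix e y 0 0 * fderiv ℝ (fun y => u (e.symm y)) y (EuclideanSpace.single 1 1) ^ 2)
        / (gramMatrix e y).det) := by
  obtain ⟨w, hw⟩ := exists_coordVec_eq he hy (gradient u (e.symm y))
  have hdet := det_gramMatrix_pos he hy
  have hsymm : gramMatrix e y 1 0 = gramMatrix e y 0 1 := by
    simp only [gramMatrix, Matrix.of_apply]
    exact real_inner_comm _ _
  rw [← inner_gradient_coordVec he hy, ← inner_gradient_coordVec he hy,
    eq_comm, Real.sqrt_eq_iff_eq_sq _ (norm_nonneg _)]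
  · rw [div_eq_iff hdet.ne', ← hw, norm_sq_coordVec]
    conv_lhs => rw [plane_eq_sum w]
    simp only [coordVec_add, coordVec_smul, inner_add_left, real_inner_smul_left]
    have h : ∀ i j, (inner ℝ (coordVec e y (EuclideanSpace.single i 1))
      (coordVec e y (EuclideanSpace.single j 1)) : ℝ) = gramMatrix e y i j := fun _ _ => rfl
    rw [h, h, h, h, Matrix.det_fin_two, hsymm]
    ring
  · rw [div_nonneg_iff]
    refine Or.inl ⟨?_, hdet.le⟩
    have h2 := norm_sq_coordVec e y (!₂[inner ℝ (gradient u (e.symm y))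
      (coordVec e y (EuclideanSpace.single 1 1)), - inner ℝ (gradient u (e.symm y))
      (coordVec e y (EuclideanSpace.single 0 1))])
    simp only [Matrix.cons_val_zero, Matrix.cons_val_one] at h2
    nlinarith [sq_nonneg ‖coordVec e y (!₂[inner ℝ (gradient u (e.symm y))
      (coordVec e y (EuclideanSpace.single 1 1)), - inner ℝ (gradient u (e.symm y))
      (coordVec e y (EuclideanSpace.single 0 1))])‖]

variable [IsContinuousRiemannianBundle Plane (fun x : M => TangentSpace (𝓡 2) x)]
  [IsRiemannianManifold (𝓡 2) M]

/-- The norm of the gradient is bounded by the pointwise Lipschitz constant: if `coordVec e y v` is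
the gradient, then `u` grows at the rate `‖∇u‖²` along the coordinate line with direction `v`, whose
speed is `‖∇u‖` up to a factor arbitrarily close to `1`. -/
lemma norm_gradient_le {u : M → ℝ} {x : M} {L : ℝ} (hL : 0 ≤ L)
    (h : ∀ᶠ x' in nhds x, |u x' - u x| ≤ L * dist x' x) : ‖gradient u x‖ ≤ L := by
  obtain ⟨e, he, y, hy, rfl⟩ : ∃ e ∈ atlas Plane M, ∃ y ∈ e.target, e.symm y = x :=
    ⟨chartAt Plane x, chart_mem_atlas _ _, chartAt Plane x x, mem_chart_target _ _,
      (chartAt Plane x).left_inv (mem_chart_source _ _)⟩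
  by_cases hd : MDifferentiableAt (𝓡 2) 𝓘(ℝ, ℝ) u (e.symm y)
  swap
  · have : gradient u (e.symm y) = 0 := by
      rw [gradient, mfderiv_zero_of_not_mdifferentiableAt hd]
      exact map_zero _
    rw [this, norm_zero]
    exact hL
  obtain ⟨v, hv⟩ := exists_coordVec_eq he hy (gradient u (e.symm y))
  set w := gradient u (e.symm y)
  have key : ∀ c : ℝ, 1 < c → ‖w‖ ≤ L * c := by
    intro c hc
    have hc0 : 0 < c := by linarith
    obtain ⟨A, hA, r, hr, hrt, hcomp⟩ := exists_ball_norm_coordVec_le he hy hc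
    have hsq : ‖w‖ ^ 2 = fderiv ℝ (fun y => u (e.symm y)) y v := by
      rw [← inner_gradient_coordVec he hy, hv, real_inner_self_eq_norm_sq]
    have hline : HasDerivAt (fun t : ℝ => y + t • v) v 0 := by
      simpa using ((hasDerivAt_id (0 : ℝ)).smul_const v).const_add y
    have hline0 : y = y + (0 : ℝ) • v := by simp
    have hder : HasDerivAt (fun t : ℝ => u (e.symm (y + t • v)))
        (fderiv ℝ (fun y => u (e.symm y)) y v) 0 := by
      have h1 := ((mdifferentiableAt_symm_iff he hy u).1 hd).hasFDerivAt
      exact HasFDerivAt.comp_hasDerivAt_of_eq (0 : ℝ) h1 hline hline0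
    have hcont : Tendsto (fun t : ℝ => y + t • v) (nhds 0) (nhds y) := by
      have := hline.continuousAt.tendsto
      simpa using this
    have hle : ‖fderiv ℝ (fun y => u (e.symm y)) y v‖ ≤ L * c * ‖w‖ := by
      refine hder.le_of_lip' (by positivity) ?_
      have h2 := hcont.eventually (Metric.ball_mem_nhds y hr)
      have h3 := ((e.continuousAt_symm hy).tendsto.comp hcont).eventually h
      filter_upwards [h2, h3] with t ht ht'
      simp only [zero_smul, add_zero, Function.comp] at ht' ⊢
      rw [Real.norm_eq_abs]
      refine ht'.trans ?_
      have h4 := dist_symm_le he hc0.le hrt (fun y hy => (hcomp y hy).1)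
        (Metric.mem_ball_self hr) ht
      rw [dist_comm] at h4
      calc L * dist (e.symm (y + t • v)) (e.symm y) ≤ L * (c * ‖A (y + t • v - y)‖) := by gcongr
        _ = L * c * ‖w‖ * ‖t - 0‖ := by
          rw [add_sub_cancel_left, map_smul, norm_smul, hA, hv, sub_zero]
          ring
    rw [← hsq, Real.norm_eq_abs, abs_of_nonneg (sq_nonneg _), sq] at hle
    by_contra! hlt
    have hw : 0 < ‖w‖ := lt_of_le_of_lt (by positivity) hlt
    exact absurd (le_of_mul_le_mul_right hle hw) (not_le.2 hlt)
  have hlim : Tendsto (fun c : ℝ => L * c) (nhdsWithin 1 (Ioi 1)) (nhds (L * 1)) :=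
    (tendsto_id.const_mul L).mono_left nhdsWithin_le_nhds
  rw [mul_one] at hlim
  refine ge_of_tendsto hlim ?_
  filter_upwards [self_mem_nhdsWithin] with c hc using key c hc

lemma norm_gradient_le_of_lipschitz {u : M → ℝ} {K : NNReal} (hu : LipschitzWith K u) (x : M) :
    ‖gradient u x‖ ≤ K :=
  norm_gradient_le K.2 (Eventually.of_forall fun x' => by
    simpa [Real.dist_eq] using hu.dist_le_mul x' x)

end Gradient

/-! ### Weak gradients of Lipschitz functions -/

section Sobolev

variable {M : Type*} [MetricSpace M] [ChartedSpace Plane M] [IsManifold (𝓡 2) 1 M]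
  [RiemannianBundle (fun x : M => TangentSpace (𝓡 2) x)]
  {e : OpenPartialHomeomorph M Plane}

section Uniqueness

variable [MeasurableSpace M] [BorelSpace M]

/-- Weak gradients are unique up to null sets. -/
lemma IsWeakGradient.ae_eq [CompactSpace M] {u : M → ℝ} {X Y : (x : M) → TangentSpace (𝓡 2) x}
    (hX : IsWeakGradient u X) (hY : IsWeakGradient u Y) :
    ∀ᵐ x ∂(riemannianVolume M), X x = Y x := by
  refine ae_of_ae_target fun e he => ?_
  have key : ∀ v : Plane, ∀ᵐ y ∂(volume : Measure Plane), y ∈ e.target →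
      (inner ℝ (X (e.symm y)) (coordVec e y v) : ℝ) - inner ℝ (Y (e.symm y)) (coordVec e y v)
        = 0 := by
    intro v
    refine e.open_target.ae_eq_zero_of_integral_contDiff_smul_eq_zero
      ((hX.locallyIntegrable_deriv e he v).sub (hY.locallyIntegrable_deriv e he v)) ?_
    intro ψ hψ hψc hψs
    have h1 := hX.integral_by_parts e he v ψ hψ hψc hψs
    have h2 := hY.integral_by_parts e he v ψ hψ hψc hψs
    have hint : ∀ Z : (x : M) → TangentSpace (𝓡 2) x, IsWeakGradient u Z →
        IntegrableOn (fun y => (inner ℝ (Z (e.symm y)) (coordVec e y v) : ℝ) * ψ y) e.target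
          volume := by
      intro Z hZ
      have h3 : IntegrableOn (fun y => (inner ℝ (Z (e.symm y)) (coordVec e y v) : ℝ) * ψ y)
          (tsupport ψ) volume :=
        ((hZ.locallyIntegrable_deriv e he v).integrableOn_compact_subset hψs hψc).mul_continuousOn
          hψ.continuous.continuousOn hψc
      refine h3.of_forall_sdiff_eq_zero e.open_target.measurableSet fun y hy => ?_
      rw [image_eq_zero_of_notMem_tsupport hy.2, mul_zero]
    rw [← setIntegral_eq_integral_of_forall_compl_eq_zero (s := e.target)]
    · have h4 : ∀ y, ψ y • ((inner ℝ (X (e.symm y)) (coordVec e y v) : ℝ)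
          - inner ℝ (Y (e.symm y)) (coordVec e y v))
          = (inner ℝ (X (e.symm y)) (coordVec e y v) : ℝ) * ψ y
            - (inner ℝ (Y (e.symm y)) (coordVec e y v) : ℝ) * ψ y := by
        intro y
        rw [smul_eq_mul]
        ring
      simp only [h4]
      rw [integral_sub (hint X hX) (hint Y hY)]
      linarith
    · intro y hy
      have : ψ y = 0 := image_eq_zero_of_notMem_tsupport fun h => hy (hψs h)
      rw [this, zero_smul]
  rw [ae_restrict_iff' e.open_target.measurableSet]
  filter_upwards [key (EuclideanSpace.single 0 1), key (EuclideanSpace.single 1 1)] with y h0 h1 hy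
  obtain ⟨w, hw⟩ := exists_coordVec_eq he hy (X (e.symm y) - Y (e.symm y))
  have h2 : (inner ℝ (X (e.symm y) - Y (e.symm y)) (coordVec e y w) : ℝ) = 0 := by
    rw [plane_eq_sum w, coordVec_add, coordVec_smul, coordVec_smul, inner_add_right,
      real_inner_smul_right, real_inner_smul_right, inner_sub_left, inner_sub_left, h0 hy, h1 hy]
    ring
  rw [hw, inner_self_eq_zero (𝕜 := ℝ)] at h2
  exact sub_eq_zero.1 h2

end Uniqueness

variable [IsContinuousRiemannianBundle Plane (fun x : M => TangentSpace (𝓡 2) x)]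

/-- No assumption on `u` is needed, since `fderiv` of any function into a complete space is
measurable. -/
lemma aemeasurable_norm_gradient [MeasurableSpace M] [BorelSpace M] [CompactSpace M] (u : M → ℝ) :
    AEMeasurable (fun x => ‖gradient u x‖) (riemannianVolume M) := by
  have hloc : ∀ e ∈ atlas Plane M,
      AEMeasurable (fun x => ‖gradient u x‖) ((riemannianVolume M).restrict e.source) := by
    intro e he
    have hG : ∀ i j, AEMeasurable (fun y => gramMatrix e y i j)
        ((volume : Measure Plane).restrict e.target) := fun i j =>
      (continuousOn_gramMatrix he i j).aemeasurable e.open_target.measurableSet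
    have hdet : AEMeasurable (fun y => (gramMatrix e y).det)
        ((volume : Measure Plane).restrict e.target) :=
      (continuousOn_det_gramMatrix he).aemeasurable e.open_target.measurableSet
    have hD : ∀ v, AEMeasurable (fun y => fderiv ℝ (fun y => u (e.symm y)) y v)
        ((volume : Measure Plane).restrict e.target) := fun v =>
      (measurable_fderiv_apply_const ℝ (fun y => u (e.symm y)) v).aemeasurable
    have hF : AEMeasurable (fun y => ‖gradient u (e.symm y)‖)
        ((volume : Measure Plane).restrict e.target) := by
      refine AEMeasurable.congr (((((hG 1 1).mul ((hD (EuclideanSpace.single 0 1)).pow_const 2)).sub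
        (((hG 0 1).const_mul 2).mul ((hD (EuclideanSpace.single 0 1)).mul
          (hD (EuclideanSpace.single 1 1))))).add
        ((hG 0 0).mul ((hD (EuclideanSpace.single 1 1)).pow_const 2))).div hdet).sqrt ?_
      filter_upwards [ae_restrict_mem e.open_target.measurableSet] with y hy
      exact (norm_gradient_symm he hy u).symm
    obtain ⟨F, hFm, hFe⟩ := hF
    have he' : AEMeasurable e ((riemannianVolume M).restrict e.source) :=
      e.continuousOn.aemeasurable e.open_source.measurableSet
    refine (hFm.comp_aemeasurable he').congr ?_
    refine ae_restrict_source_of_ae_target he ?_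
    filter_upwards [hFe, ae_restrict_mem e.open_target.measurableSet] with y hy hyt
    simp only [Function.comp, e.right_inv hyt]
    exact hy.symm
  obtain ⟨s, -, hs⟩ := isCompact_univ.elim_nhds_subcover (fun x : M => (chartAt Plane x).source)
    (fun x _ => (chartAt Plane x).open_source.mem_nhds (mem_chart_source Plane x))
  have hs' : (⋃ i : s, (chartAt Plane (i : M)).source) = univ := by
    refine eq_univ_of_forall fun x => ?_
    obtain ⟨i, hi, hx⟩ := mem_iUnion₂.1 (hs (mem_univ x))
    exact mem_iUnion.2 ⟨⟨i, hi⟩, hx⟩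
  rw [← Measure.restrict_univ (μ := riemannianVolume M), ← hs', aemeasurable_iUnion_iff]
  exact fun i => hloc _ (chart_mem_atlas _ _)

variable [IsRiemannianManifold (𝓡 2) M]

/-- A Lipschitz function is locally Lipschitz in charts. -/
lemma locallyLipschitzOn_symm (he : e ∈ atlas Plane M) {u : M → ℝ} {K : NNReal}
    (hu : LipschitzWith K u) {y₀ : Plane} (hy₀ : y₀ ∈ e.target) :
    ∃ (C : NNReal) (r : ℝ), 0 < r ∧ Metric.ball y₀ r ⊆ e.target ∧
      LipschitzOnWith C (fun y => u (e.symm y)) (Metric.ball y₀ r) := by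
  obtain ⟨A, -, r, hr, hrt, hcomp⟩ := exists_ball_norm_coordVec_le he hy₀ one_lt_two
  refine ⟨K * (2 * ‖(A : Plane →L[ℝ] Plane)‖₊), r, hr, hrt, ?_⟩
  refine LipschitzOnWith.of_dist_le_mul fun y hy y' hy' => ?_
  refine (hu.dist_le_mul _ _).trans ?_
  rw [NNReal.coe_mul, mul_assoc]
  gcongr
  refine (dist_symm_le he zero_le_two hrt (fun y hy => (hcomp y hy).1) hy hy').trans ?_
  rw [dist_eq_norm, ← norm_neg (y - y'), neg_sub, NNReal.coe_mul, coe_nnnorm, NNReal.coe_ofNat,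
    mul_assoc]
  gcongr
  exact (A : Plane →L[ℝ] Plane).le_opNorm _

/-- Rademacher's theorem in a chart. -/
lemma ae_differentiableAt_symm (he : e ∈ atlas Plane M) {u : M → ℝ} {K : NNReal}
    (hu : LipschitzWith K u) : ∀ᵐ y ∂(volume : Measure Plane), y ∈ e.target →
      DifferentiableAt ℝ (fun y => u (e.symm y)) y := by
  refine measure_null_of_locally_null _ fun y₀ hy₀ => ?_
  have hy₀t : y₀ ∈ e.target := by
    by_contra h
    exact hy₀ fun h' => absurd h' h
  obtain ⟨C, r, hr, -, hlip⟩ := locallyLipschitzOn_symm he hu hy₀t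
  have h := hlip.ae_differentiableWithinAt_of_mem (μ := (volume : Measure Plane))
  refine ⟨_, inter_mem self_mem_nhdsWithin (mem_nhdsWithin_of_mem_nhds
    (Metric.ball_mem_nhds y₀ hr)), measure_mono_null ?_ h⟩
  intro y hy h'
  exact hy.1 fun _ => (h' hy.2).differentiableAt (Metric.isOpen_ball.mem_nhds hy.2)

/-- The gradient of a Lipschitz function, which exists almost everywhere, is its weak gradient. -/
lemma isWeakGradient_gradient {u : M → ℝ} {K : NNReal} (hu : LipschitzWith K u) :
    IsWeakGradient u (gradient u) where
  locallyIntegrable_fun e he :=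
    (hu.continuous.comp_continuousOn e.continuousOn_symm).locallyIntegrableOn
      e.open_target.measurableSet
  locallyIntegrable_deriv e he v := by
    have h : LocallyIntegrableOn (fun y => fderiv ℝ (fun y => u (e.symm y)) y v) e.target
        volume := by
      intro y₀ hy₀
      obtain ⟨C, r, hr, -, hlip⟩ := locallyLipschitzOn_symm he hu hy₀
      refine ⟨Metric.ball y₀ r, mem_nhdsWithin_of_mem_nhds (Metric.ball_mem_nhds y₀ hr), ?_⟩
      refine Measure.integrableOn_of_bounded (M := C * ‖v‖) measure_ball_lt_top.ne
        (measurable_fderiv_apply_const ℝ (fun y => u (e.symm y)) v).aestronglyMeasurable ?_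
      filter_upwards [ae_restrict_mem Metric.isOpen_ball.measurableSet] with y hy
      refine ((fderiv ℝ (fun y => u (e.symm y)) y).le_opNorm v).trans ?_
      gcongr
      exact norm_fderiv_le_of_lipschitzOn ℝ (Metric.isOpen_ball.mem_nhds hy) hlip
    exact h.congr ((ae_restrict_mem e.open_target.measurableSet).mono fun y hy =>
      (inner_gradient_coordVec he hy u v).symm)
  integral_by_parts e he v ψ hψ hψc hψs := by
    set f : Plane → ℝ := fun y => u (e.symm y) with hf
    obtain ⟨K', hK'c, hK'1, hK'2⟩ := exists_compact_between hψc e.open_target hψs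
    have hloc : LocallyLipschitzOn K' f := by
      intro y hy
      obtain ⟨C, r, hr, -, hlip⟩ := locallyLipschitzOn_symm he hu (hK'2 hy)
      exact ⟨C, _, mem_nhdsWithin_of_mem_nhds (Metric.ball_mem_nhds y hr), hlip⟩
    obtain ⟨C, hC⟩ := hloc.exists_lipschitzOnWith_of_compact hK'c
    obtain ⟨g, hg, hfg⟩ := hC.extend_real
    obtain ⟨D, hD⟩ := hψ.lipschitzWith_of_hasCompactSupport hψc (by simp)
    have hparts := hg.integral_lineDeriv_mul_eq (μ := (volume : Measure Plane)) hD hψc v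
    have hψdiff : Differentiable ℝ ψ := hψ.differentiable (by simp)
    have hψ0 : ∀ y, y ∉ tsupport ψ → ψ y = 0 := fun y hy => image_eq_zero_of_notMem_tsupport hy
    have hdψ0 : ∀ y, y ∉ tsupport ψ → fderiv ℝ ψ y = 0 := fun y hy =>
      image_eq_zero_of_notMem_tsupport fun h => hy (tsupport_fderiv_subset ℝ h)
    have hleft : ∫ y in e.target, f y * fderiv ℝ ψ y v = ∫ y, g y * fderiv ℝ ψ y v := by
      rw [setIntegral_eq_integral_of_forall_compl_eq_zero]
      · refine integral_congr_ae (Eventually.of_forall fun y => ?_)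
        by_cases hy : y ∈ tsupport ψ
        · simp only [hfg (interior_subset (hK'1 hy))]
        · simp [hdψ0 y hy]
      · intro y hy
        simp [hdψ0 y fun h => hy (hψs h)]
    have hright : ∫ y in e.target, (inner ℝ (gradient u (e.symm y)) (coordVec e y v) : ℝ) * ψ y
        = ∫ y, lineDeriv ℝ g y v * ψ y := by
      rw [setIntegral_eq_integral_of_forall_compl_eq_zero]
      · refine integral_congr_ae ?_
        filter_upwards [ae_differentiableAt_symm he hu] with y hdiff
        by_cases hy : y ∈ tsupport ψ
        · have hyt := hψs hy
          have h1 : g =ᶠ[nhds y] f := by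
            filter_upwards [isOpen_interior.mem_nhds (hK'1 hy)] with z hz
            exact (hfg (interior_subset hz)).symm
          have h2 : DifferentiableAt ℝ g y := (hdiff hyt).congr_of_eventuallyEq h1
          rw [inner_gradient_coordVec he hyt, h2.lineDeriv_eq_fderiv, h1.fderiv_eq]
        · simp [hψ0 y hy]
      · intro y hy
        simp [hψ0 y fun h => hy (hψs h)]
    rw [hleft, hright, hparts, ← integral_neg]
    refine integral_congr_ae (Eventually.of_forall fun y => ?_)
    simp only [(hψdiff y).lineDeriv_eq_fderiv, map_neg]
    ring

variable [MeasurableSpace M] [BorelSpace M] [CompactSpace M]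

lemma ae_mdifferentiableAt {u : M → ℝ} {K : NNReal} (hu : LipschitzWith K u) :
    ∀ᵐ x ∂(riemannianVolume M), MDifferentiableAt (𝓡 2) 𝓘(ℝ, ℝ) u x := by
  refine ae_of_ae_target fun e he => ?_
  rw [ae_restrict_iff' e.open_target.measurableSet]
  filter_upwards [ae_differentiableAt_symm he hu] with y h hy
  exact (mdifferentiableAt_symm_iff he hy u).2 (h hy)

lemma weakGradient_ae_eq {u : M → ℝ} {K : NNReal} (hu : LipschitzWith K u) :
    ∀ᵐ x ∂(riemannianVolume M), weakGradient u x = gradient u x := by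
  have h : ∃ X, IsWeakGradient u X := ⟨_, isWeakGradient_gradient hu⟩
  rw [weakGradient, dif_pos h]
  exact h.choose_spec.ae_eq (isWeakGradient_gradient hu)

lemma memH1_of_lipschitz [IsFiniteMeasure (riemannianVolume M)] {u : M → ℝ} {K : NNReal}
    (hu : LipschitzWith K u) : MemH1 u := by
  obtain ⟨C, hC⟩ :=
    (isCompact_univ (X := M)).exists_bound_of_continuousOn hu.continuous.continuousOn
  refine ⟨MemLp.of_bound hu.continuous.aestronglyMeasurable C
    (Eventually.of_forall fun x => hC x (mem_univ x)), gradient u, isWeakGradient_gradient hu,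
    MemLp.of_bound (aemeasurable_norm_gradient u).aestronglyMeasurable K
      (Eventually.of_forall fun x => ?_)⟩
  rw [norm_norm]
  exact norm_gradient_le_of_lipschitz hu x

end Sobolev

/-! ### The logarithm of a weighted sum -/

section Profile

variable {k : ℕ} {t a b : Fin k → ℝ}

lemma sum_mul_pos (ht : ∀ j, 0 ≤ t j) (hsum : ∑ j, t j = 1) (ha : ∀ j, 0 < a j) :
    0 < ∑ j, t j * a j := by
  obtain ⟨j, -, hj⟩ : ∃ j ∈ Finset.univ, 0 < t j := by
    by_contra! h
    have := Finset.sum_nonpos h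
    linarith
  exact Finset.sum_pos' (fun i _ => mul_nonneg (ht i) (ha i).le) ⟨j, Finset.mem_univ j,
    mul_pos hj (ha j)⟩

/-- Passing to the logarithm of a convex combination preserves pointwise bounds between the
logarithms of its terms; this is what makes all estimates uniform in the weights. -/
lemma log_sum_le_log_sum_add (ht : ∀ j, 0 ≤ t j) (hsum : ∑ j, t j = 1) (ha : ∀ j, 0 < a j)
    (hb : ∀ j, 0 < b j) {q : ℝ} (h : ∀ j, Real.log (a j) ≤ Real.log (b j) + q) :
    Real.log (∑ j, t j * a j) ≤ Real.log (∑ j, t j * b j) + q := by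
  have h1 : ∑ j, t j * a j ≤ (∑ j, t j * b j) * Real.exp q := by
    rw [Finset.sum_mul]
    refine Finset.sum_le_sum fun j _ => ?_
    rw [mul_assoc]
    refine mul_le_mul_of_nonneg_left ?_ (ht j)
    have := Real.exp_le_exp.2 (h j)
    rwa [Real.exp_add, Real.exp_log (ha j), Real.exp_log (hb j)] at this
  have h2 := Real.log_le_log (sum_mul_pos ht hsum ha) h1
  rwa [Real.log_mul (sum_mul_pos ht hsum hb).ne' (Real.exp_ne_zero q), Real.log_exp] at h2

lemma abs_log_sum_sub_le (ht : ∀ j, 0 ≤ t j) (hsum : ∑ j, t j = 1) (ha : ∀ j, 0 < a j)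
    (hb : ∀ j, 0 < b j) {q : ℝ} (h : ∀ j, |Real.log (a j) - Real.log (b j)| ≤ q) :
    |Real.log (∑ j, t j * a j) - Real.log (∑ j, t j * b j)| ≤ q := by
  rw [abs_le]
  constructor
  · have := log_sum_le_log_sum_add ht hsum hb ha (q := q) fun j => by
      linarith [(abs_le.1 (h j)).1]
    linarith
  · have := log_sum_le_log_sum_add ht hsum ha hb (q := q) fun j => by
      linarith [(abs_le.1 (h j)).2]
    linarith

lemma log_profile (Λ s : ℝ) :
    Real.log ((1 / (1 + Λ ^ 2 * s ^ 2)) ^ 2) = -2 * Real.log (1 + Λ ^ 2 * s ^ 2) := by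
  rw [Real.log_pow, one_div, Real.log_inv]
  push_cast
  ring

/-- A bound for the logarithmic derivative of the profile on `[m, ∞)` is a Lipschitz constant of its
logarithm there. -/
lemma abs_log_profile_sub_le {Λ m C : ℝ}
    (hC : ∀ s, m ≤ s → |4 * Λ ^ 2 * s / (1 + Λ ^ 2 * s ^ 2)| ≤ C) {s s' : ℝ} (hs : m ≤ s)
    (hs' : m ≤ s') :
    |Real.log ((1 / (1 + Λ ^ 2 * s ^ 2)) ^ 2) - Real.log ((1 / (1 + Λ ^ 2 * s' ^ 2)) ^ 2)|
      ≤ C * |s - s'| := by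
  rw [log_profile, log_profile]
  have hder : ∀ s ∈ Ici m, HasDerivWithinAt (fun s => -2 * Real.log (1 + Λ ^ 2 * s ^ 2))
      (-(4 * Λ ^ 2 * s / (1 + Λ ^ 2 * s ^ 2))) (Ici m) s := by
    intro s _
    have hpos : 1 + Λ ^ 2 * s ^ 2 ≠ 0 := by positivity
    have h1 : HasDerivAt (fun s : ℝ => 1 + Λ ^ 2 * s ^ 2) (Λ ^ 2 * (2 * s)) s := by
      have := ((hasDerivAt_pow 2 s).const_mul (Λ ^ 2)).const_add 1
      simpa using this
    have h2 := ((h1.log hpos).const_mul (-2)).hasDerivWithinAt (s := Ici m)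
    have h3 : -(4 * Λ ^ 2 * s / (1 + Λ ^ 2 * s ^ 2))
        = -2 * (Λ ^ 2 * (2 * s) / (1 + Λ ^ 2 * s ^ 2)) := by ring
    rw [h3]
    exact h2
  have := (convex_Ici m).norm_image_sub_le_of_norm_hasDerivWithin_le (C := C) hder
    (fun s hs => by rw [norm_neg]; exact hC s hs) hs' hs
  simpa [Real.norm_eq_abs] using this

lemma abs_profile_deriv_le {Λ : ℝ} (hΛ : 0 ≤ Λ) (s : ℝ) :
    |4 * Λ ^ 2 * s / (1 + Λ ^ 2 * s ^ 2)| ≤ 2 * Λ := by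
  have h : 0 < 1 + Λ ^ 2 * s ^ 2 := by positivity
  rw [abs_div, abs_of_pos h, div_le_iff₀ h, abs_mul, abs_of_nonneg (by positivity), ← sq_abs s]
  nlinarith [mul_nonneg hΛ (sq_nonneg (Λ * |s| - 1))]

lemma abs_profile_deriv_le_div {Λ m : ℝ} (hm : 0 < m) {s : ℝ} (hs : m ≤ s) :
    |4 * Λ ^ 2 * s / (1 + Λ ^ 2 * s ^ 2)| ≤ 4 / m := by
  have h : 0 < 1 + Λ ^ 2 * s ^ 2 := by positivity
  have hs0 : 0 < s := by linarith
  rw [abs_of_nonneg (by positivity), div_le_div_iff₀ h hm]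
  nlinarith [mul_nonneg (mul_nonneg (sq_nonneg Λ) hs0.le) (sub_nonneg.2 hs)]

end Profile

/-! ### Bubbles -/

section Bubble

variable {M : Type*} [MetricSpace M] {k : ℕ}

/-- The function `log ∑ⱼ tⱼ (1 / (1 + Λ² d(·, xⱼ)²))²`. -/
def bubble (Λ : ℝ) (t : Fin k → ℝ) (x : Fin k → M) (y : M) : ℝ :=
  Real.log (∑ j, t j * (1 / (1 + Λ ^ 2 * dist y (x j) ^ 2)) ^ 2)

variable {Λ : ℝ} {t : Fin k → ℝ} {x : Fin k → M}

lemma profile_pos (Λ s : ℝ) : 0 < (1 / (1 + Λ ^ 2 * s ^ 2)) ^ 2 := by positivity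

lemma abs_bubble_sub_le (ht : ∀ j, 0 ≤ t j) (hsum : ∑ j, t j = 1) {m C : ℝ} (hC0 : 0 ≤ C)
    (hC : ∀ s, m ≤ s → |4 * Λ ^ 2 * s / (1 + Λ ^ 2 * s ^ 2)| ≤ C) {y y' : M}
    (hy : ∀ j, m ≤ dist y (x j)) (hy' : ∀ j, m ≤ dist y' (x j)) :
    |bubble Λ t x y - bubble Λ t x y'| ≤ C * dist y y' := by
  refine abs_log_sum_sub_le ht hsum (fun j => profile_pos _ _) (fun j => profile_pos _ _)
    fun j => ?_
  refine (abs_log_profile_sub_le hC (hy j) (hy' j)).trans ?_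
  gcongr
  exact abs_dist_sub_le _ _ _

lemma lipschitzWith_bubble (hΛ : 0 ≤ Λ) (ht : ∀ j, 0 ≤ t j) (hsum : ∑ j, t j = 1) :
    LipschitzWith (2 * Λ).toNNReal (bubble Λ t x) := by
  refine LipschitzWith.of_dist_le_mul fun y y' => ?_
  rw [Real.coe_toNNReal _ (by positivity), Real.dist_eq]
  exact abs_bubble_sub_le ht hsum (by positivity) (m := 0) (fun s _ => abs_profile_deriv_le hΛ s)
    (fun _ => dist_nonneg) (fun _ => dist_nonneg)

lemma bubble_le (ht : ∀ j, 0 ≤ t j) (hsum : ∑ j, t j = 1) {y : M} {m : ℝ} (hm : 0 ≤ m)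
    (hy : ∀ j, m ≤ dist y (x j)) : bubble Λ t x y ≤ -2 * Real.log (1 + Λ ^ 2 * m ^ 2) := by
  have := log_sum_le_log_sum_add (b := fun _ => 1) ht hsum
    (fun j => profile_pos Λ (dist y (x j))) (fun j => one_pos)
    (q := -2 * Real.log (1 + Λ ^ 2 * m ^ 2)) fun j => by
      rw [log_profile, Real.log_one, zero_add]
      have : Real.log (1 + Λ ^ 2 * m ^ 2) ≤ Real.log (1 + Λ ^ 2 * dist y (x j) ^ 2) := by
        have := hy j
        gcongr
      linarith
  simpa [hsum, bubble] using this

lemma bubble_nonpos (ht : ∀ j, 0 ≤ t j) (hsum : ∑ j, t j = 1) (y : M) : bubble Λ t x y ≤ 0 := by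
  simpa using bubble_le (Λ := Λ) (x := x) ht hsum le_rfl (fun j => dist_nonneg (x := y) (y := x j))

lemma le_bubble (ht : ∀ j, 0 ≤ t j) (hsum : ∑ j, t j = 1) (hΛ : 0 ≤ Λ) {y : M} {D : ℝ}
    (hy : ∀ j, dist y (x j) ≤ D) :
    -4 * Real.log (max 1 Λ) - 2 * Real.log (1 + D ^ 2) ≤ bubble Λ t x y := by
  have h1 : ∀ j, Real.log (1 + Λ ^ 2 * dist y (x j) ^ 2)
      ≤ 2 * Real.log (max 1 Λ) + Real.log (1 + D ^ 2) := by
    intro j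
    have h2 : 0 < max 1 Λ := lt_max_of_lt_left one_pos
    have h3 : 1 + Λ ^ 2 * dist y (x j) ^ 2 ≤ max 1 Λ ^ 2 * (1 + D ^ 2) := by
      have h4 : 1 ≤ max 1 Λ ^ 2 := one_le_pow₀ (le_max_left _ _)
      have h5 : Λ ^ 2 * dist y (x j) ^ 2 ≤ max 1 Λ ^ 2 * D ^ 2 := by
        have := hy j
        gcongr
        exact le_max_right _ _
      linarith
    have h6 := Real.log_le_log (by positivity) h3
    rwa [Real.log_mul (by positivity) (by positivity), Real.log_pow, Nat.cast_ofNat] at h6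
  have := log_sum_le_log_sum_add (a := fun _ => 1) ht hsum (fun j => one_pos)
    (fun j => profile_pos Λ (dist y (x j)))
    (q := 4 * Real.log (max 1 Λ) + 2 * Real.log (1 + D ^ 2)) fun j => by
      rw [log_profile, Real.log_one]
      linarith [h1 j]
  simp only [mul_one, hsum, Real.log_one] at this
  unfold bubble
  linarith

/-- The function `4 / d(·, z)²`, truncated at the height `Λ²`. -/
def truncInvSq (Λ : ℝ) (z y : M) : ℝ := 4 / max (dist y z) (2 / Λ) ^ 2

lemma max_dist_pos (hΛ : 0 < Λ) (z y : M) : 0 < max (dist y z) (2 / Λ) :=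
  lt_max_of_lt_right (by positivity)

lemma truncInvSq_pos (hΛ : 0 < Λ) (z y : M) : 0 < truncInvSq Λ z y := by
  have := max_dist_pos hΛ z y
  unfold truncInvSq
  positivity

lemma truncInvSq_le (hΛ : 0 < Λ) (z y : M) : truncInvSq Λ z y ≤ Λ ^ 2 := by
  have h := max_dist_pos hΛ z y
  unfold truncInvSq
  rw [div_le_iff₀ (by positivity), ← mul_pow]
  have : 2 ≤ Λ * max (dist y z) (2 / Λ) := by
    calc 2 = Λ * (2 / Λ) := by field_simp
      _ ≤ _ := by gcongr; exact le_max_right _ _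
  nlinarith

lemma continuous_truncInvSq (hΛ : 0 < Λ) (z : M) : Continuous (truncInvSq Λ z) := by
  unfold truncInvSq
  refine continuous_const.div (by fun_prop) fun y => ?_
  have := max_dist_pos hΛ z y
  positivity

lemma mem_ball_of_lt_truncInvSq (hΛ : 0 < Λ) {s : ℝ} (hs : 0 < s) (z y : M)
    (h : s < truncInvSq Λ z y) :
    y ∈ Metric.ball z (2 / Real.sqrt s) := by
  have h1 := max_dist_pos hΛ z y
  unfold truncInvSq at h
  rw [lt_div_iff₀ (by positivity)] at h
  have h2 : 0 < Real.sqrt s := Real.sqrt_pos.2 hs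
  rw [Metric.mem_ball, lt_div_iff₀ h2]
  have h3 : max (dist y z) (2 / Λ) * Real.sqrt s < 2 := by
    refine lt_of_pow_lt_pow_left₀ 2 zero_le_two ?_
    rw [mul_pow, Real.sq_sqrt hs.le]
    linarith
  refine lt_of_le_of_lt ?_ h3
  gcongr
  exact le_max_left _ _

/-- Pointwise, a bubble exceeds `-4 log Λ` by at most twice the logarithm of the sum `S` of the
truncated inverse squared distances. The tangent line inequality `log S ≤ S / A + log A` makes this
integrable with an arbitrarily small multiple of `S`. -/
lemma bubble_le_sum_truncInvSq (ht : ∀ j, 0 ≤ t j) (hsum : ∑ j, t j = 1) {A : ℝ}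
    (hA : 1 ≤ A) (y : M) : bubble Λ t x y ≤ -4 * Real.log (max 1 Λ) +
      2 * ((∑ j, truncInvSq (max 1 Λ) (x j) y) / A + Real.log A) := by
  have hA0 : 0 < A := by linarith
  have hmax : 0 < max 1 Λ := lt_max_of_lt_left one_pos
  have hS0 : 0 ≤ ∑ j, truncInvSq (max 1 Λ) (x j) y :=
    Finset.sum_nonneg fun j _ => (truncInvSq_pos hmax _ _).le
  rcases le_or_gt Λ 1 with h1 | h1
  · rw [max_eq_left h1] at hS0 ⊢
    have := bubble_nonpos (Λ := Λ) (x := x) ht hsum y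
    have h2 : 0 ≤ (∑ j, truncInvSq 1 (x j) y) / A := by positivity
    have h3 := Real.log_nonneg hA
    rw [Real.log_one]
    linarith
  rw [max_eq_right h1.le] at hS0 ⊢
  have hΛ0 : 0 < Λ := by linarith
  set S := ∑ j, truncInvSq Λ (x j) y with hS
  have hSpos : 0 < S := by
    have hk : (Finset.univ : Finset (Fin k)).Nonempty := by
      by_contra h
      rw [Finset.not_nonempty_iff_eq_empty] at h
      simp [h] at hsum
    exact Finset.sum_pos (fun j _ => truncInvSq_pos hΛ0 _ _) hk
  have hlogS : Real.log S ≤ S / A + Real.log A := by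
    have h2 := Real.log_le_sub_one_of_pos (div_pos hSpos hA0)
    rw [Real.log_div hSpos.ne' hA0.ne'] at h2
    linarith
  have hj : ∀ j, Real.log ((1 / (1 + Λ ^ 2 * dist y (x j) ^ 2)) ^ 2)
      ≤ 2 * Real.log S - 4 * Real.log Λ := by
    intro j
    rw [log_profile]
    have h3 : Λ ^ 2 / S ≤ 1 + Λ ^ 2 * dist y (x j) ^ 2 := by
      have h4 : truncInvSq Λ (x j) y ≤ S :=
        Finset.single_le_sum (f := fun j => truncInvSq Λ (x j) y)
          (fun j _ => (truncInvSq_pos hΛ0 _ _).le) (Finset.mem_univ j)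
      refine (div_le_div_of_nonneg_left (sq_nonneg Λ) (truncInvSq_pos hΛ0 _ _) h4).trans ?_
      unfold truncInvSq
      rw [div_div_eq_mul_div, div_le_iff₀ four_pos]
      rcases max_cases (dist y (x j)) (2 / Λ) with ⟨h5, -⟩ | ⟨h5, -⟩
      · rw [h5]
        nlinarith [mul_nonneg (sq_nonneg Λ) (sq_nonneg (dist y (x j)))]
      · rw [h5, div_pow, mul_div_cancel₀ _ (by positivity)]
        nlinarith [mul_nonneg (sq_nonneg Λ) (sq_nonneg (dist y (x j)))]
    have h6 := Real.log_le_log (by positivity) h3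
    rw [Real.log_div (by positivity) hSpos.ne', Real.log_pow, Nat.cast_ofNat] at h6
    linarith
  have := log_sum_le_log_sum_add (b := fun _ => 1) ht hsum
    (fun j => profile_pos Λ (dist y (x j))) (fun j => one_pos)
    (q := 2 * Real.log S - 4 * Real.log Λ) fun j => by
      rw [Real.log_one, zero_add]
      exact hj j
  simp only [mul_one, hsum, Real.log_one, zero_add] at this
  unfold bubble
  linarith

variable [MeasurableSpace M] [BorelSpace M] {ν : Measure M} [IsProbabilityMeasure ν]

lemma integrable_bubble [CompactSpace M] (hΛ : 0 ≤ Λ) (ht : ∀ j, 0 ≤ t j) (hsum : ∑ j, t j = 1) :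
    Integrable (bubble Λ t x) ν := by
  have hc := (lipschitzWith_bubble (x := x) hΛ ht hsum).continuous
  obtain ⟨C, hC⟩ := (isCompact_univ (X := M)).exists_bound_of_continuousOn hc.continuousOn
  exact Integrable.of_bound hc.aestronglyMeasurable C
    (Eventually.of_forall fun y => hC y (mem_univ y))

lemma integrable_truncInvSq (hΛ : 0 < Λ) (z : M) : Integrable (truncInvSq Λ z) ν := by
  refine Integrable.of_bound (continuous_truncInvSq hΛ z).aestronglyMeasurable (Λ ^ 2)
    (Eventually.of_forall fun y => ?_)
  rw [Real.norm_eq_abs, abs_of_pos (truncInvSq_pos hΛ z y)]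
  exact truncInvSq_le hΛ z y

lemma integral_bubble_le [CompactSpace M] (hΛ : 0 ≤ Λ) (ht : ∀ j, 0 ≤ t j)
    (hsum : ∑ j, t j = 1) {A : ℝ} (hA : 1 ≤ A) : ∫ y, bubble Λ t x y ∂ν ≤ -4 * Real.log (max 1 Λ) +
      2 * ((∫ y, ∑ j, truncInvSq (max 1 Λ) (x j) y ∂ν) / A + Real.log A) := by
  have hm : 0 < max 1 Λ := lt_max_of_lt_left one_pos
  have i₁ : Integrable (fun y => ∑ j, truncInvSq (max 1 Λ) (x j) y) ν :=
    integrable_finsetSum _ fun j _ => integrable_truncInvSq hm _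
  have i₂ : Integrable (fun y => 2 * ((∑ j, truncInvSq (max 1 Λ) (x j) y) / A + Real.log A))
      ν := ((i₁.div_const A).add (integrable_const _)).const_mul 2
  have ib := integrable_bubble (ν := ν) (x := x) hΛ ht hsum
  calc _ ≤ ∫ y, (-4 * Real.log (max 1 Λ) +
        2 * ((∑ j, truncInvSq (max 1 Λ) (x j) y) / A + Real.log A)) ∂ν :=
        integral_mono ib ((integrable_const _).add i₂) fun y =>
          bubble_le_sum_truncInvSq ht hsum hA y
    _ = _ := by
        rw [integral_add (integrable_const _) i₂, integral_const_mul (2 : ℝ),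
          integral_add (i₁.div_const A) (integrable_const _), integral_div]
        simp

lemma le_integral_bubble [CompactSpace M] (hΛ : 0 ≤ Λ) (ht : ∀ j, 0 ≤ t j) (hsum : ∑ j, t j = 1) :
    -4 * Real.log (max 1 Λ) - 2 * Real.log (1 + Metric.diam (univ : Set M) ^ 2)
      ≤ ∫ y, bubble Λ t x y ∂ν := by
  calc _ = ∫ _, (-4 * Real.log (max 1 Λ) - 2 * Real.log (1 + Metric.diam (univ : Set M) ^ 2))
        ∂ν := by simp
    _ ≤ _ := integral_mono (integrable_const _) (integrable_bubble hΛ ht hsum) fun y =>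
        le_bubble ht hsum hΛ fun j => Metric.dist_le_diam_of_mem isCompact_univ.isBounded
          (mem_univ _) (mem_univ _)

/-- If small balls have area at most `b s²`, then the truncated inverse squared distance has
integral at most `8 b log Λ`, up to a constant, by the layer cake formula. -/
lemma exists_integral_truncInvSq_le {b ρ : ℝ} (hb : 0 ≤ b) (hρ : 0 < ρ)
    (hball : ∀ z : M, ∀ s, 0 < s → s < ρ → ν (Metric.ball z s) ≤ ENNReal.ofReal (b * s ^ 2)) :
    ∃ C, ∀ z : M, ∀ Λ, 1 ≤ Λ → ∫ y, truncInvSq Λ z y ∂ν ≤ 8 * b * Real.log Λ + C := by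
  -- below the height `T` the superlevel sets are bounded by the total mass, above it they are
  -- balls of radius less than `ρ`
  set T : ℝ := max 1 (4 / ρ ^ 2) with hT
  have hT1 : 1 ≤ T := le_max_left _ _
  have hT0 : 0 < T := by linarith
  refine ⟨T, fun z Λ hΛ => ?_⟩
  have hΛ0 : 0 < Λ := by linarith
  have hlog : 0 ≤ Real.log Λ := Real.log_nonneg hΛ
  rcases le_or_gt (Λ ^ 2) T with hle | hlt
  · calc ∫ y, truncInvSq Λ z y ∂ν ≤ ∫ _, T ∂ν :=
          integral_mono (integrable_truncInvSq hΛ0 z) (integrable_const _)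
            fun y => (truncInvSq_le hΛ0 z y).trans hle
      _ = T := by simp
      _ ≤ _ := by
        have : 0 ≤ 8 * b * Real.log Λ := by positivity
        linarith
  have hnn : 0 ≤ᵐ[ν] truncInvSq Λ z := Eventually.of_forall fun y => (truncInvSq_pos hΛ0 z y).le
  have hmeas : AEMeasurable (truncInvSq Λ z) ν := (continuous_truncInvSq hΛ0 z).aemeasurable
  have hbound : 0 ≤ 8 * b * Real.log Λ + T := by positivity
  rw [integral_eq_lintegral_of_nonneg_ae hnn hmeas.aestronglyMeasurable]
  refine ENNReal.toReal_le_of_le_ofReal hbound ?_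
  rw [lintegral_eq_lintegral_meas_lt ν hnn hmeas]
  have hsplit : Ioi (0 : ℝ) = Ioc 0 T ∪ (Ioc T (Λ ^ 2) ∪ Ioi (Λ ^ 2)) := by
    rw [Ioc_union_Ioi_eq_Ioi hlt.le, Ioc_union_Ioi_eq_Ioi hT0.le]
  have h1 : ∫⁻ s in Ioc 0 T, ν {y | s < truncInvSq Λ z y} ≤ ENNReal.ofReal T := by
    calc _ ≤ ∫⁻ _ in Ioc 0 T, 1 := lintegral_mono fun s => prob_le_one
      _ = ENNReal.ofReal T := by simp
  have h2 : ∫⁻ s in Ioc T (Λ ^ 2), ν {y | s < truncInvSq Λ z y}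
      ≤ ENNReal.ofReal (8 * b * Real.log Λ) := by
    calc _ ≤ ∫⁻ s in Ioc T (Λ ^ 2), ENNReal.ofReal (4 * b * s⁻¹) := by
          refine setLIntegral_mono' measurableSet_Ioc fun s hs => ?_
          have hs0 : 0 < s := hT0.trans hs.1
          have hsq : 0 < Real.sqrt s := Real.sqrt_pos.2 hs0
          refine (measure_mono fun y hy => mem_ball_of_lt_truncInvSq hΛ0 hs0 z y hy).trans ?_
          refine (hball z _ (by positivity) ?_).trans ?_
          · rw [div_lt_iff₀ hsq]
            have h3 : 4 / ρ ^ 2 < s := (le_max_right _ _).trans_lt hs.1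
            rw [div_lt_iff₀ (by positivity)] at h3
            refine lt_of_pow_lt_pow_left₀ 2 (by positivity) ?_
            rw [mul_pow, Real.sq_sqrt hs0.le]
            linarith
          · refine ENNReal.ofReal_le_ofReal (le_of_eq ?_)
            rw [div_pow, Real.sq_sqrt hs0.le]
            field_simp
            norm_num
      _ = ENNReal.ofReal (∫ s in Ioc T (Λ ^ 2), 4 * b * s⁻¹) := by
          rw [ofReal_integral_eq_lintegral_ofReal]
          · have : ContinuousOn (fun s : ℝ => 4 * b * s⁻¹) (Icc T (Λ ^ 2)) :=
              continuousOn_const.mul (continuousOn_inv₀.mono fun s hs => (hT0.trans_le hs.1).ne')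
            exact this.integrableOn_Icc.mono_set Ioc_subset_Icc_self
          · filter_upwards [ae_restrict_mem measurableSet_Ioc] with s hs
            have : 0 < s := hT0.trans hs.1
            positivity
      _ ≤ ENNReal.ofReal (8 * b * Real.log Λ) := by
          refine ENNReal.ofReal_le_ofReal ?_
          rw [← intervalIntegral.integral_of_le hlt.le, intervalIntegral.integral_const_mul,
            integral_inv_of_pos hT0 (by positivity), Real.log_div (by positivity) hT0.ne',
            Real.log_pow, Nat.cast_ofNat]
          nlinarith [Real.log_nonneg hT1, mul_nonneg hb (Real.log_nonneg hT1)]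
  have h3 : ∫⁻ s in Ioi (Λ ^ 2), ν {y | s < truncInvSq Λ z y} = 0 := by
    have h4 : ∀ s ∈ Ioi (Λ ^ 2), ν {y | s < truncInvSq Λ z y} = 0 := by
      intro s hs
      have : {y | s < truncInvSq Λ z y} = ∅ :=
        eq_empty_of_forall_notMem fun y hy =>
          absurd (truncInvSq_le hΛ0 z y) (not_le.2 ((mem_Ioi.1 hs).trans hy))
      rw [this, measure_empty]
    rw [setLIntegral_congr_fun measurableSet_Ioi h4, lintegral_zero]
  rw [hsplit]
  calc _ ≤ (∫⁻ s in Ioc 0 T, ν {y | s < truncInvSq Λ z y}) +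
        ((∫⁻ s in Ioc T (Λ ^ 2), ν {y | s < truncInvSq Λ z y}) +
          ∫⁻ s in Ioi (Λ ^ 2), ν {y | s < truncInvSq Λ z y}) :=
        (lintegral_union_le _ _ _).trans (by gcongr; exact lintegral_union_le _ _ _)
    _ ≤ ENNReal.ofReal T + (ENNReal.ofReal (8 * b * Real.log Λ) + 0) := by
        rw [h3]
        gcongr
    _ = ENNReal.ofReal (8 * b * Real.log Λ + T) := by
        rw [add_zero, ← ENNReal.ofReal_add hT0.le (by positivity), add_comm]

end Bubble

/-! ### The Dirichlet energy of the test functions -/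

lemma exists_lipschitzWith_comb {X : Type*} [PseudoEMetricSpace X] {v₁ v₂ : X → ℝ} {K₁ K₂ : NNReal}
    (h₁ : LipschitzWith K₁ v₁) (h₂ : LipschitzWith K₂ v₂) (a b : ℝ) :
    ∃ K, LipschitzWith K (fun y => a * v₁ y + b * v₂ y) :=
  ⟨_, ((lipschitzWith_smul a).comp h₁).add ((lipschitzWith_smul b).comp h₂)⟩

section Energy

variable {M : Type*} [MetricSpace M] [ChartedSpace Plane M] [IsManifold (𝓡 2) 1 M]
  [RiemannianBundle (fun x : M => TangentSpace (𝓡 2) x)]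
  [IsContinuousRiemannianBundle Plane (fun x : M => TangentSpace (𝓡 2) x)]
  [IsRiemannianManifold (𝓡 2) M]
  {k l : ℕ} {Λ Λ₁ Λ₂ : ℝ} {t : Fin k → ℝ} {x : Fin k → M} {s : Fin l → ℝ} {z : Fin l → M}

lemma norm_gradient_bubble_le (hΛ : 0 ≤ Λ) (ht : ∀ j, 0 ≤ t j) (hsum : ∑ j, t j = 1) (y : M) :
    ‖gradient (bubble Λ t x) y‖ ≤ 2 * Λ :=
  norm_gradient_le (by positivity) (Eventually.of_forall fun y' =>
    abs_bubble_sub_le ht hsum (by positivity) (m := 0) (fun s _ => abs_profile_deriv_le hΛ s)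
      (fun _ => dist_nonneg) (fun _ => dist_nonneg))

/-- At distance at least `m` from all centres, the gradient is bounded independently of the
concentration parameter. -/
lemma norm_gradient_bubble_le_div (ht : ∀ j, 0 ≤ t j) (hsum : ∑ j, t j = 1) {y : M} {m : ℝ}
    (hm : 0 < m) (hy : ∀ j, m ≤ dist y (x j)) : ‖gradient (bubble Λ t x) y‖ ≤ 4 / m := by
  have key : ∀ m', 0 < m' → m' < m → ‖gradient (bubble Λ t x) y‖ ≤ 4 / m' := by
    intro m' hm' hlt
    refine norm_gradient_le (by positivity) ?_
    filter_upwards [Metric.ball_mem_nhds y (sub_pos.2 hlt)] with y' hy'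
    refine abs_bubble_sub_le ht hsum (by positivity) (m := m')
      (fun s hs => abs_profile_deriv_le_div hm' hs) (fun j => ?_) (fun j => hlt.le.trans (hy j))
    have h1 := dist_triangle_left y (x j) y'
    have h2 := hy j
    rw [Metric.mem_ball] at hy'
    linarith
  have hlim : Tendsto (fun m' : ℝ => 4 / m') (nhdsWithin m (Iio m)) (nhds (4 / m)) :=
    (tendsto_const_nhds.div tendsto_id hm.ne').mono_left nhdsWithin_le_nhds
  refine ge_of_tendsto hlim ?_
  filter_upwards [Ioo_mem_nhdsLT hm] with m' hm' using key m' hm'.1 hm'.2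

/-- The pointwise energy bound: only the nearest centre contributes, which is why the number `k`
of centres enters linearly in the Dirichlet energy. -/
lemma norm_gradient_bubble_sq_le (hΛ : 0 ≤ Λ) (ht : ∀ j, 0 ≤ t j) (hsum : ∑ j, t j = 1) (y : M) :
    ‖gradient (bubble Λ t x) y‖ ^ 2 ≤ 4 * ∑ j, truncInvSq (max 1 Λ) (x j) y := by
  have hmax : 0 < max 1 Λ := lt_max_of_lt_left one_pos
  have hk : (Finset.univ : Finset (Fin k)).Nonempty := by
    by_contra h
    rw [Finset.not_nonempty_iff_eq_empty] at h
    simp [h] at hsum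
  obtain ⟨i, -, hi⟩ := Finset.exists_min_image Finset.univ (fun j => dist y (x j)) hk
  have h1 : truncInvSq (max 1 Λ) (x i) y ≤ ∑ j, truncInvSq (max 1 Λ) (x j) y :=
    Finset.single_le_sum (f := fun j => truncInvSq (max 1 Λ) (x j) y)
      (fun j _ => (truncInvSq_pos hmax _ _).le) (Finset.mem_univ i)
  refine le_trans ?_ (mul_le_mul_of_nonneg_left h1 zero_le_four)
  unfold truncInvSq
  rcases max_cases (dist y (x i)) (2 / max 1 Λ) with ⟨h2, h3⟩ | ⟨h2, -⟩
  · have hpos : 0 < dist y (x i) := lt_of_lt_of_le (by positivity) h3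
    have h4 := norm_gradient_bubble_le_div (Λ := Λ) ht hsum hpos fun j => hi j (Finset.mem_univ j)
    rw [h2]
    calc _ ≤ (4 / dist y (x i)) ^ 2 := by gcongr
      _ = _ := by ring
  · rw [h2]
    calc _ ≤ (2 * Λ) ^ 2 := by
          have := norm_gradient_bubble_le (x := x) hΛ ht hsum y
          gcongr
      _ ≤ (2 * max 1 Λ) ^ 2 := by gcongr; exact le_max_right _ _
      _ = _ := by field_simp; norm_num

/-- Young's inequality for the product of the gradients of two bubbles with separated centres: near
the centres of one of them the gradient of the other one is bounded. -/
lemma norm_gradient_mul_le (ht : ∀ j, 0 ≤ t j) (hsum : ∑ j, t j = 1) (hs : ∀ j, 0 ≤ s j)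
    (hssum : ∑ j, s j = 1) {δ : ℝ} (hδ : 0 < δ) (hsep : ∀ i j, 2 * δ ≤ dist (x i) (z j)) {ε : ℝ}
    (hε : 0 < ε) (y : M) :
    ‖gradient (bubble Λ₁ t x) y‖ * ‖gradient (bubble Λ₂ s z) y‖
      ≤ ε * (‖gradient (bubble Λ₁ t x) y‖ ^ 2 + ‖gradient (bubble Λ₂ s z) y‖ ^ 2)
        + 4 / (ε * δ ^ 2) := by
  have young : ∀ p q : ℝ, 0 ≤ p → 0 ≤ q → p ≤ 4 / δ → p * q ≤ ε * q ^ 2 + 4 / (ε * δ ^ 2) := by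
    intro p q hp hq h
    have h1 : p ^ 2 ≤ (4 / δ) ^ 2 := by gcongr
    have h2 : 4 / (ε * δ ^ 2) = (4 / δ) ^ 2 / (4 * ε) := by field_simp
    have h3 : p ^ 2 / (4 * ε) ≤ (4 / δ) ^ 2 / (4 * ε) := by gcongr
    have h4 : 0 ≤ ε * (q - p / (2 * ε)) ^ 2 := by positivity
    have h5 : ε * (q - p / (2 * ε)) ^ 2 = ε * q ^ 2 - p * q + p ^ 2 / (4 * ε) := by
      field_simp
      ring
    linarith
  have hX := norm_nonneg (gradient (bubble Λ₁ t x) y)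
  have hY := norm_nonneg (gradient (bubble Λ₂ s z) y)
  by_cases h : ∀ i, δ ≤ dist y (x i)
  · have h1 := young _ _ hX hY (norm_gradient_bubble_le_div ht hsum hδ h)
    have h2 : 0 ≤ ε * ‖gradient (bubble Λ₁ t x) y‖ ^ 2 := by positivity
    linarith
  · push Not at h
    obtain ⟨i, hi⟩ := h
    have h0 : ∀ j, δ ≤ dist y (z j) := by
      intro j
      have := dist_triangle_left (x i) (z j) y
      have := hsep i j
      linarith
    have h1 := young _ _ hY hX (norm_gradient_bubble_le_div hs hssum hδ h0)
    have h2 : 0 ≤ ε * ‖gradient (bubble Λ₂ s z) y‖ ^ 2 := by positivity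
    linarith

variable [MeasurableSpace M] [BorelSpace M] [CompactSpace M]

/-- In terms of `v₁` and `v₂`, the quadratic form of `(v₁ - v₂ / 2, -v₁ / 2 + v₂)` is
`(|∇v₁|² + |∇v₂|² - ∇v₁ · ∇v₂) / 4`. -/
lemma quadForm_ae_eq {v₁ v₂ : M → ℝ} {K₁ K₂ : NNReal} (h₁ : LipschitzWith K₁ v₁)
    (h₂ : LipschitzWith K₂ v₂) : ∀ᵐ y ∂(riemannianVolume M),
    quadForm (fun y => v₁ y - 1 / 2 * v₂ y) (fun y => -(1 / 2) * v₁ y + v₂ y) y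
      = 1 / 4 * (‖gradient v₁ y‖ ^ 2 + ‖gradient v₂ y‖ ^ 2
        - inner ℝ (gradient v₁ y) (gradient v₂ y)) := by
  obtain ⟨K, hK⟩ := exists_lipschitzWith_comb h₁ h₂ 1 (-(1 / 2))
  obtain ⟨K', hK'⟩ := exists_lipschitzWith_comb h₁ h₂ (-(1 / 2)) 1
  have e₁ : (fun y => v₁ y - 1 / 2 * v₂ y) = fun y => 1 * v₁ y + -(1 / 2) * v₂ y := by
    ext y; ring
  have e₂ : (fun y => -(1 / 2) * v₁ y + v₂ y) = fun y => -(1 / 2) * v₁ y + 1 * v₂ y := by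
    ext y; ring
  rw [e₁, e₂]
  filter_upwards [weakGradient_ae_eq hK, weakGradient_ae_eq hK', ae_mdifferentiableAt h₁,
    ae_mdifferentiableAt h₂] with y hy hy' hd₁ hd₂
  rw [quadForm, hy, hy', gradient_add_smul hd₁ hd₂, gradient_add_smul hd₁ hd₂]
  simp only [← real_inner_self_eq_norm_sq, inner_add_left, inner_add_right, real_inner_smul_left,
    real_inner_smul_right]
  rw [real_inner_comm (gradient v₁ y) (gradient v₂ y)]
  ring

variable [IsProbabilityMeasure (riemannianVolume M)]

/-- The energy bound. The product of the two gradients is absorbed because the centres `x i` and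
`z j` are separated. -/
lemma integral_quadForm_le (hΛ₁ : 0 ≤ Λ₁) (hΛ₂ : 0 ≤ Λ₂) (ht : ∀ j, 0 ≤ t j)
    (hsum : ∑ j, t j = 1) (hs : ∀ j, 0 ≤ s j)
    (hssum : ∑ j, s j = 1) {δ : ℝ} (hδ : 0 < δ) (hsep : ∀ i j, 2 * δ ≤ dist (x i) (z j)) {ε : ℝ}
    (hε : 0 < ε) :
    ∫ y, quadForm (fun y => bubble Λ₁ t x y - 1 / 2 * bubble Λ₂ s z y)
        (fun y => -(1 / 2) * bubble Λ₁ t x y + bubble Λ₂ s z y) y ∂(riemannianVolume M)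
      ≤ (1 + ε) * (∫ y, ∑ j, truncInvSq (max 1 Λ₁) (x j) y ∂(riemannianVolume M)
          + ∫ y, ∑ j, truncInvSq (max 1 Λ₂) (z j) y ∂(riemannianVolume M)) + 1 / (ε * δ ^ 2) := by
  have hm₁ : 0 < max 1 Λ₁ := lt_max_of_lt_left one_pos
  have hm₂ : 0 < max 1 Λ₂ := lt_max_of_lt_left one_pos
  have i₁ : Integrable (fun y => ∑ j, truncInvSq (max 1 Λ₁) (x j) y) (riemannianVolume M) :=
    integrable_finsetSum _ fun j _ => integrable_truncInvSq hm₁ _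
  have i₂ : Integrable (fun y => ∑ j, truncInvSq (max 1 Λ₂) (z j) y) (riemannianVolume M) :=
    integrable_finsetSum _ fun j _ => integrable_truncInvSq hm₂ _
  have i₁₂ : Integrable (fun y => (1 + ε) * ((∑ j, truncInvSq (max 1 Λ₁) (x j) y)
      + ∑ j, truncInvSq (max 1 Λ₂) (z j) y)) (riemannianVolume M) := (i₁.add i₂).const_mul _
  have hform := quadForm_ae_eq (lipschitzWith_bubble (x := x) hΛ₁ ht hsum)
    (lipschitzWith_bubble (x := z) hΛ₂ hs hssum)
  have hcs : ∀ y, |(inner ℝ (gradient (bubble Λ₁ t x) y) (gradient (bubble Λ₂ s z) y) : ℝ)|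
      ≤ ‖gradient (bubble Λ₁ t x) y‖ * ‖gradient (bubble Λ₂ s z) y‖ :=
    fun y => abs_real_inner_le_norm _ _
  calc _ ≤ ∫ y, ((1 + ε) * ((∑ j, truncInvSq (max 1 Λ₁) (x j) y)
          + ∑ j, truncInvSq (max 1 Λ₂) (z j) y) + 1 / (ε * δ ^ 2)) ∂(riemannianVolume M) := by
        refine integral_mono_of_nonneg ?_ (i₁₂.add (integrable_const _)) ?_
        · filter_upwards [hform] with y hy
          rw [Pi.zero_apply, hy]
          have h1 := (abs_le.1 (hcs y)).2
          nlinarith [sq_nonneg (‖gradient (bubble Λ₁ t x) y‖ - ‖gradient (bubble Λ₂ s z) y‖),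
            sq_nonneg ‖gradient (bubble Λ₁ t x) y‖, sq_nonneg ‖gradient (bubble Λ₂ s z) y‖]
        · filter_upwards [hform] with y hy
          rw [hy]
          have h1 := (abs_le.1 (hcs y)).1
          have h2 := norm_gradient_mul_le (Λ₁ := Λ₁) (Λ₂ := Λ₂) ht hsum hs hssum hδ hsep hε y
          have h3 := norm_gradient_bubble_sq_le (x := x) hΛ₁ ht hsum y
          have h4 := norm_gradient_bubble_sq_le (x := z) hΛ₂ hs hssum y
          have h5 : 4 / (ε * δ ^ 2) = 4 * (1 / (ε * δ ^ 2)) := by ring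
          rw [h5] at h2
          nlinarith
    _ = _ := by
        rw [integral_add i₁₂ (integrable_const _), integral_const_mul,
          integral_add i₁ i₂]
        simp

end Energy

/-! ### The exponential mass -/

section Mass

variable {M : Type*} [MetricSpace M]

lemma exists_pos_le_on_thickening [CompactSpace M] {Γ U : Set M} {w : M → ℝ} (hΓ : IsCompact Γ)
    (hU : IsOpen U) (hΓU : Γ ⊆ U) (hw : ContinuousOn w U) (hpos : ∀ y ∈ U, 0 < w y) :
    ∃ δ > 0, ∃ a > 0, ∀ x ∈ Γ, ∀ y, dist y x ≤ δ → a ≤ w y := by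
  obtain ⟨δ, hδ, hsub⟩ := hΓ.exists_cthickening_subset_open hU hΓU
  have hc : IsCompact (Metric.cthickening δ Γ) := Metric.isClosed_cthickening.isCompact
  have hmem : ∀ x ∈ Γ, ∀ y, dist y x ≤ δ → y ∈ Metric.cthickening δ Γ := fun x hx y hy =>
    Metric.mem_cthickening_of_dist_le y x δ Γ hx hy
  rcases (Metric.cthickening δ Γ).eq_empty_or_nonempty with h | h
  · exact ⟨δ, hδ, 1, one_pos, fun x hx y hy => absurd (hmem x hx y hy) (by simp [h])⟩
  · obtain ⟨y₀, hy₀, hmin⟩ := hc.exists_isMinOn h (hw.mono hsub)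
    exact ⟨δ, hδ, w y₀, hpos _ (hsub hy₀), fun x hx y hy => hmin (hmem x hx y hy)⟩

lemma exists_pos_le_dist {Γ₁ Γ₂ : Set M} (h₁ : IsCompact Γ₁) (h₂ : IsCompact Γ₂)
    (h : Disjoint Γ₁ Γ₂) : ∃ δ > 0, ∀ x ∈ Γ₁, ∀ z ∈ Γ₂, δ ≤ dist x z := by
  rcases (Γ₁ ×ˢ Γ₂).eq_empty_or_nonempty with he | hne
  · exact ⟨1, one_pos, fun x hx z hz => absurd (mk_mem_prod hx hz) (by simp [he])⟩
  · obtain ⟨⟨x₀, z₀⟩, h0, hmin⟩ := (h₁.prod h₂).exists_isMinOn hne continuous_dist.continuousOn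
    refine ⟨dist x₀ z₀, dist_pos.2 fun heq => ?_, fun x hx z hz => hmin (mk_mem_prod hx hz)⟩
    exact disjoint_left.1 h h0.1 (heq ▸ h0.2)

/-- The lower bound of the mass is obtained on a disc of radius comparable to `1 / Λ₁` around a
centre of weight at least `1 / k`. -/
lemma exists_le_lintegral_exp [MeasurableSpace M] [BorelSpace M] {ν : Measure M} {b ρ : ℝ}
    (hb : 0 < b) (hρ : 0 < ρ)
    (hball : ∀ z : M, ∀ s, 0 < s → s < ρ → ENNReal.ofReal (b * s ^ 2) ≤ ν (Metric.ball z s))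
    {Γ₁ Γ₂ : Set M} {w : M → ℝ} {δ a : ℝ} (hδ : 0 < δ) (ha : 0 < a)
    (hw : ∀ x ∈ Γ₁, ∀ y, dist y x ≤ δ → a ≤ w y)
    (hsep : ∀ x ∈ Γ₁, ∀ z ∈ Γ₂, 2 * δ ≤ dist x z) (hk : 0 < k) :
    ∃ c > 0, ∀ (l : ℕ) (Λ₁ Λ₂ : ℝ) (t : Fin k → ℝ) (x : Fin k → M) (s : Fin l → ℝ)
      (z : Fin l → M), 0 ≤ Λ₁ → 0 ≤ Λ₂ → (∀ j, 0 ≤ t j) → ∑ j, t j = 1 → (∀ j, x j ∈ Γ₁) →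
      (∀ j, 0 ≤ s j) → ∑ j, s j = 1 → (∀ j, z j ∈ Γ₂) →
      ENNReal.ofReal (c * (max 1 Λ₂ ^ 2 / max 1 Λ₁ ^ 2)) ≤
        ∫⁻ y, ENNReal.ofReal (w y * Real.exp (bubble Λ₁ t x y - 1 / 2 * bubble Λ₂ s z y)) ∂ν := by
  set τ := min (min δ 1) (ρ / 2) with hτ
  have hτ0 : 0 < τ := by positivity
  have hτδ : τ ≤ δ := (min_le_left _ _).trans (min_le_left _ _)
  have hτ1 : τ ≤ 1 := (min_le_left _ _).trans (min_le_right _ _)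
  have hτρ : τ < ρ := lt_of_le_of_lt (min_le_right _ _) (by linarith)
  have hk' : (0 : ℝ) < k := by exact_mod_cast hk
  refine ⟨a * (1 / k * (1 / 4)) * τ ^ 2 * b * τ ^ 2, by positivity, ?_⟩
  intro l Λ₁ Λ₂ t x s z hΛ₁ hΛ₂ ht hsum hx hs hssum hz
  set Λ := max 1 Λ₁
  set Λ' := max 1 Λ₂
  have hΛ1 : 1 ≤ Λ := le_max_left _ _
  have hΛ0 : 0 < Λ := by linarith
  have hΛ'0 : 0 < Λ' := lt_max_of_lt_left one_pos
  obtain ⟨i, -, hi⟩ : ∃ i ∈ Finset.univ, 1 / (k : ℝ) ≤ t i := by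
    by_contra! h
    have hne : (Finset.univ : Finset (Fin k)).Nonempty := ⟨⟨0, hk⟩, Finset.mem_univ _⟩
    have h1 := Finset.sum_lt_sum_of_nonempty hne h
    rw [hsum] at h1
    simp [hk'.ne'] at h1
  have hr0 : 0 < τ / Λ := by positivity
  have hrτ : τ / Λ ≤ τ := div_le_self hτ0.le hΛ1
  have hpt : ∀ y ∈ Metric.ball (x i) (τ / Λ), a * (1 / k * (1 / 4)) * τ ^ 2 * Λ' ^ 2
      ≤ w y * Real.exp (bubble Λ₁ t x y - 1 / 2 * bubble Λ₂ s z y) := by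
    intro y hy
    have hyd : dist y (x i) < τ / Λ := hy
    have h1 : a ≤ w y := hw (x i) (hx i) y (by linarith)
    have h2 : 1 / (k : ℝ) * (1 / 4) ≤ Real.exp (bubble Λ₁ t x y) := by
      unfold bubble
      rw [Real.exp_log (sum_mul_pos ht hsum fun j => profile_pos _ _)]
      refine le_trans ?_ (Finset.single_le_sum
        (f := fun j => t j * (1 / (1 + Λ₁ ^ 2 * dist y (x j) ^ 2)) ^ 2)
        (fun j _ => mul_nonneg (ht j) (profile_pos _ _).le) (Finset.mem_univ i))
      refine mul_le_mul hi ?_ (by norm_num) (ht i)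
      have h3 : Λ₁ * dist y (x i) ≤ 1 := by
        calc Λ₁ * dist y (x i) ≤ Λ * (τ / Λ) := by
              gcongr
              exact le_max_right _ _
          _ = τ := by field_simp
          _ ≤ 1 := hτ1
      have h4 : 1 + Λ₁ ^ 2 * dist y (x i) ^ 2 ≤ 2 := by
        have : 0 ≤ Λ₁ * dist y (x i) := by positivity
        nlinarith
      calc (1 / 4 : ℝ) = (1 / 2) ^ 2 := by norm_num
        _ ≤ _ := by gcongr
    have h5 : τ ^ 2 * Λ' ^ 2 ≤ Real.exp (-(1 / 2 * bubble Λ₂ s z y)) := by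
      have h6 : ∀ j, τ ≤ dist y (z j) := by
        intro j
        have h7 := dist_triangle_left (x i) (z j) y
        have h8 := hsep _ (hx i) _ (hz j)
        linarith
      have h9 := bubble_le (Λ := Λ₂) hs hssum hτ0.le h6
      have h10 : Real.log (1 + Λ₂ ^ 2 * τ ^ 2) ≤ -(1 / 2 * bubble Λ₂ s z y) := by linarith
      have h11 := Real.exp_le_exp.2 h10
      rw [Real.exp_log (by positivity)] at h11
      refine le_trans ?_ h11
      rcases max_cases 1 Λ₂ with ⟨h12, -⟩ | ⟨h12, -⟩
      · rw [show Λ' = 1 from h12]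
        nlinarith [mul_nonneg (sq_nonneg Λ₂) (sq_nonneg τ)]
      · rw [show Λ' = Λ₂ from h12]
        linarith
    rw [sub_eq_add_neg, Real.exp_add]
    calc a * (1 / k * (1 / 4)) * τ ^ 2 * Λ' ^ 2
        = a * ((1 / k * (1 / 4)) * (τ ^ 2 * Λ' ^ 2)) := by ring
      _ ≤ w y * (Real.exp (bubble Λ₁ t x y) * Real.exp (-(1 / 2 * bubble Λ₂ s z y))) := by
        have : 0 ≤ w y := ha.le.trans h1
        gcongr
  calc ENNReal.ofReal (a * (1 / k * (1 / 4)) * τ ^ 2 * b * τ ^ 2 * (Λ' ^ 2 / Λ ^ 2))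
      = ENNReal.ofReal (a * (1 / k * (1 / 4)) * τ ^ 2 * Λ' ^ 2)
        * ENNReal.ofReal (b * (τ / Λ) ^ 2) := by
        rw [← ENNReal.ofReal_mul (by positivity)]
        congr 1
        field_simp
    _ ≤ ENNReal.ofReal (a * (1 / k * (1 / 4)) * τ ^ 2 * Λ' ^ 2)
        * ν (Metric.ball (x i) (τ / Λ)) := by
        gcongr
        exact hball _ _ hr0 (hrτ.trans_lt hτρ)
    _ = ∫⁻ _ in Metric.ball (x i) (τ / Λ),
          ENNReal.ofReal (a * (1 / k * (1 / 4)) * τ ^ 2 * Λ' ^ 2) ∂ν :=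
        (setLIntegral_const _ _).symm
    _ ≤ ∫⁻ y in Metric.ball (x i) (τ / Λ),
          ENNReal.ofReal (w y * Real.exp (bubble Λ₁ t x y - 1 / 2 * bubble Λ₂ s z y)) ∂ν :=
        setLIntegral_mono' Metric.isOpen_ball.measurableSet fun y hy =>
          ENNReal.ofReal_le_ofReal (hpt y hy)
    _ ≤ _ := setLIntegral_le_lintegral _ _

end Mass

/-! ### The upper bound for the functional -/

section Functional

/-- The terms of the functional that involve logarithms of integrals are bounded from above
when these integrals are bounded from below. -/
lemma ereal_mul_sub_log_le {ρ I m : ℝ} (hρ : 0 ≤ ρ) (hm : 0 < m) {N : ℝ≥0∞}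
    (h : ENNReal.ofReal m ≤ N) :
    (ρ : EReal) * ((I : EReal) - ENNReal.log N) ≤ ((ρ * (I - Real.log m) : ℝ) : EReal) := by
  have h1 : ((Real.log m : ℝ) : EReal) ≤ ENNReal.log N := by
    rw [← ENNReal.log_ofReal_of_pos hm]
    exact ENNReal.log_monotone h
  rw [EReal.coe_mul, EReal.coe_sub]
  exact mul_le_mul_of_nonneg_left (EReal.sub_le_sub le_rfl h1) (EReal.coe_nonneg.2 hρ)

/-- With `I` and `J` the mean values of the two bubbles and `L`, `L'` the logarithms of their
concentration parameters: in the difference between the mean value of a component of the test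
function and the logarithm of its mass only `L` survives. -/
lemma mean_sub_log_le {I J L L' S ε B C₀ D c n : ℝ} (hε : 0 ≤ ε) (hS : S ≤ n * (B * L + C₀))
    (hI : I ≤ -4 * L + 2 * (S * ε + -Real.log ε)) (hJ : -4 * L' - 2 * D ≤ J) :
    I - 1 / 2 * J - (c + 2 * L' - 2 * L)
      ≤ (-2 + 2 * ε * (n * B)) * L + (2 * ε * (n * C₀) - 2 * Real.log ε + D - c) := by
  have h := mul_le_mul_of_nonneg_right hS hε
  linarith

/-- The coefficient of the logarithm of the concentration parameter in the upper bound for the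
functional is negative as soon as the error parameter `ε` is small. -/
lemma eventually_coefficient_neg {k : ℕ} {ρ : ℝ} (hρ : 4 * k * Real.pi < ρ) :
    ∀ᶠ ε : ℝ in nhdsWithin 0 (Ioi 0),
      (1 + ε) * (k * (8 * ((1 + ε) * Real.pi))) + ρ * (-2 + 2 * ε * (k * (8 * ((1 + ε) * Real.pi))))
        < 0 := by
  have hc : Continuous fun ε : ℝ => (1 + ε) * (k * (8 * ((1 + ε) * Real.pi)))
      + ρ * (-2 + 2 * ε * (k * (8 * ((1 + ε) * Real.pi)))) := by fun_prop
  refine (hc.tendsto 0).mono_left nhdsWithin_le_nhds |>.eventually_lt_const ?_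
  simp only [add_zero, one_mul, mul_zero, zero_mul]
  linarith

section Weight

variable {M : Type*} [MetricSpace M] [ChartedSpace Plane M]
  [RiemannianBundle (fun x : M => TangentSpace (𝓡 2) x)] [MeasurableSpace M]

/-- If there is no Green function with pole `p`, then `greenFunction p` is the constant `0`, so that
continuity away from `p` holds in either case. -/
lemma continuousOn_greenFunction (p : M) : ContinuousOn (greenFunction p) {p}ᶜ := by
  unfold greenFunction
  split_ifs with h
  · exact h.choose_spec.continuousOn
  · exact continuousOn_const

lemma continuousOn_singularWeight {m : ℕ} (p : Fin m → M) (α : Fin m → ℝ) {h : M → ℝ}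
    (hh : Continuous h) : ContinuousOn (singularWeight p α h) (range p)ᶜ := by
  unfold singularWeight
  refine hh.continuousOn.mul (Real.continuous_exp.comp_continuousOn (continuousOn_const.mul ?_))
  refine continuousOn_finsetSum _ fun j _ => continuousOn_const.mul ?_
  exact (continuousOn_greenFunction (p j)).mono fun y hy h => hy ⟨j, (mem_singleton_iff.1 h).symm⟩

end Weight

variable {M : Type*} [MetricSpace M] [ChartedSpace Plane M] [IsManifold (𝓡 2) 1 M]
  [RiemannianBundle (fun x : M => TangentSpace (𝓡 2) x)]
  [IsContinuousRiemannianBundle Plane (fun x : M => TangentSpace (𝓡 2) x)]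
  [IsRiemannianManifold (𝓡 2) M] [MeasurableSpace M] [BorelSpace M] [CompactSpace M]
  [IsProbabilityMeasure (riemannianVolume M)]

/-- The energy estimate: the functional tends to `-∞` linearly in the logarithms of the two
concentration parameters. -/
lemma exists_todaFunctional_le {Γ₁ Γ₂ : Set M} (hΓ₁ : IsCompact Γ₁) (hΓ₂ : IsCompact Γ₂)
    (hΓ : Disjoint Γ₁ Γ₂) {U : Set M} (hU : IsOpen U) (hΓU₁ : Γ₁ ⊆ U) (hΓU₂ : Γ₂ ⊆ U)
    {w₁ w₂ : M → ℝ} (hw₁ : ContinuousOn w₁ U) (hw₂ : ContinuousOn w₂ U)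
    (hw₁0 : ∀ y ∈ U, 0 < w₁ y) (hw₂0 : ∀ y ∈ U, 0 < w₂ y) {k l : ℕ} (hk : 0 < k) (hl : 0 < l)
    {ρ₁ ρ₂ : ℝ} (hρ₁ : 4 * k * Real.pi < ρ₁) (hρ₂ : 4 * l * Real.pi < ρ₂) :
    ∃ a > 0, ∃ C : ℝ, ∀ (Λ₁ Λ₂ : ℝ) (t : Fin k → ℝ) (x : Fin k → M) (s : Fin l → ℝ)
      (z : Fin l → M), 0 ≤ Λ₁ → 0 ≤ Λ₂ → (∀ j, 0 ≤ t j) → ∑ j, t j = 1 → (∀ j, x j ∈ Γ₁) →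
      (∀ j, 0 ≤ s j) → ∑ j, s j = 1 → (∀ j, z j ∈ Γ₂) →
      todaFunctional ρ₁ ρ₂ w₁ w₂ (fun y => bubble Λ₁ t x y - 1 / 2 * bubble Λ₂ s z y)
        (fun y => -(1 / 2) * bubble Λ₁ t x y + bubble Λ₂ s z y)
      ≤ ((C - a * (Real.log (max 1 Λ₁) + Real.log (max 1 Λ₂)) : ℝ) : EReal) := by
  -- `ε` absorbs the errors in the areas of balls, in Young's inequality and in the mean values
  obtain ⟨ε, ⟨hε₁, hε₂⟩, hε0, hε1⟩ := (((eventually_coefficient_neg hρ₁).and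
    (eventually_coefficient_neg hρ₂)).and (Ioo_mem_nhdsGT one_pos)).exists
  have hρ₁0 : 0 ≤ ρ₁ := le_trans (by positivity) hρ₁.le
  have hρ₂0 : 0 ≤ ρ₂ := le_trans (by positivity) hρ₂.le
  -- the error `ε / 7` in the metric is such that areas of balls are `π s²` up to a factor `1 + ε`
  obtain ⟨ρ, hρ, hvol⟩ := exists_volume_ball (M := M) (c := 1 + ε / 7) (by linarith)
  have hc3 : (1 + ε / 7) ^ 3 ≤ 1 + ε := by
    nlinarith [mul_pos hε0 hε0, mul_pos (mul_pos hε0 hε0) hε0]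
  set b : ℝ := (1 + ε) * Real.pi with hb
  have hb0 : 0 ≤ b := by have := Real.pi_pos; positivity
  obtain ⟨C₀, hC₀⟩ := exists_integral_truncInvSq_le (ν := riemannianVolume M) hb0 hρ
    fun z s hs hsρ => ((hvol z s hs hsρ).1).trans <| ENNReal.ofReal_le_ofReal <| by
      rw [hb]
      have := Real.pi_pos
      gcongr
  set b' : ℝ := ((1 + ε / 7) ^ 3)⁻¹ * Real.pi with hb'
  have hb'0 : 0 < b' := by have := Real.pi_pos; positivity
  -- the separation of the curves, and of the curves from the singular points
  obtain ⟨d, hd, hsep⟩ := exists_pos_le_dist hΓ₁ hΓ₂ hΓ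
  obtain ⟨δ₁, hδ₁, a₁, ha₁, hwa₁⟩ := exists_pos_le_on_thickening hΓ₁ hU hΓU₁ hw₁ hw₁0
  obtain ⟨δ₂, hδ₂, a₂, ha₂, hwa₂⟩ := exists_pos_le_on_thickening hΓ₂ hU hΓU₂ hw₂ hw₂0
  set δ := min (d / 2) (min δ₁ δ₂) with hδ
  have hδ0 : 0 < δ := by positivity
  have hδd : 2 * δ ≤ d := by linarith [min_le_left (d / 2) (min δ₁ δ₂)]
  have hδδ₁ : δ ≤ δ₁ := (min_le_right _ _).trans (min_le_left _ _)
  have hδδ₂ : δ ≤ δ₂ := (min_le_right _ _).trans (min_le_right _ _)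
  obtain ⟨c₁, hc₁, hmass₁⟩ := exists_le_lintegral_exp (Γ₂ := Γ₂) hb'0 hρ
    (fun z s hs hsρ => (hvol z s hs hsρ).2) hδ0 ha₁
    (fun x hx y hy => hwa₁ x hx y (hy.trans hδδ₁))
    (fun x hx z hz => hδd.trans (hsep x hx z hz)) hk
  obtain ⟨c₂, hc₂, hmass₂⟩ := exists_le_lintegral_exp (Γ₂ := Γ₁) hb'0 hρ
    (fun z s hs hsρ => (hvol z s hs hsρ).2) hδ0 ha₂
    (fun x hx y hy => hwa₂ x hx y (hy.trans hδδ₂))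
    (fun x hx z hz => hδd.trans (dist_comm x z ▸ hsep z hz x hx)) hl
  set D := Real.log (1 + Metric.diam (univ : Set M) ^ 2)
  set A₁ := (1 + ε) * (k * (8 * b)) + ρ₁ * (-2 + 2 * ε * (k * (8 * b))) with hA₁
  set A₂ := (1 + ε) * (l * (8 * b)) + ρ₂ * (-2 + 2 * ε * (l * (8 * b))) with hA₂
  refine ⟨min (-A₁) (-A₂), lt_min (neg_pos.2 hε₁) (neg_pos.2 hε₂),
    (1 + ε) * (k * C₀ + l * C₀) + 1 / (ε * δ ^ 2)
      + ρ₁ * (2 * ε * (k * C₀) - 2 * Real.log ε + D - Real.log c₁)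
      + ρ₂ * (2 * ε * (l * C₀) - 2 * Real.log ε + D - Real.log c₂), ?_⟩
  intro Λ₁ Λ₂ t x s z hΛ₁ hΛ₂ ht hsum hx hs hssum hz
  set L₁ := Real.log (max 1 Λ₁)
  set L₂ := Real.log (max 1 Λ₂)
  have hL₁ : 0 ≤ L₁ := Real.log_nonneg (le_max_left _ _)
  have hL₂ : 0 ≤ L₂ := Real.log_nonneg (le_max_left _ _)
  have hm₁ : 0 < max 1 Λ₁ := lt_max_of_lt_left one_pos
  have hm₂ : 0 < max 1 Λ₂ := lt_max_of_lt_left one_pos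
  have hsum_le : ∀ (n : ℕ) (Λ : ℝ) (q : Fin n → M),
      ∫ y, ∑ j, truncInvSq (max 1 Λ) (q j) y ∂(riemannianVolume M)
        ≤ n * (8 * b * Real.log (max 1 Λ) + C₀) := by
    intro n Λ q
    rw [integral_finsetSum _ fun j _ => integrable_truncInvSq (lt_max_of_lt_left one_pos) _]
    calc _ ≤ ∑ _j : Fin n, (8 * b * Real.log (max 1 Λ) + C₀) :=
          Finset.sum_le_sum fun j _ => hC₀ _ _ (le_max_left _ _)
      _ = _ := by simp [mul_add]
  have hS₁ := hsum_le k Λ₁ x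
  have hS₂ := hsum_le l Λ₂ z
  set S₁ := ∫ y, ∑ j, truncInvSq (max 1 Λ₁) (x j) y ∂(riemannianVolume M)
  set S₂ := ∫ y, ∑ j, truncInvSq (max 1 Λ₂) (z j) y ∂(riemannianVolume M)
  have hQ := integral_quadForm_le hΛ₁ hΛ₂ ht hsum hs hssum hδ0
    (fun i j => hδd.trans (hsep _ (hx i) _ (hz j))) hε0
  have hε1' : 1 ≤ 1 / ε := by
    rw [le_div_iff₀ hε0]
    linarith
  have hI₁ := integral_bubble_le (ν := riemannianVolume M) (x := x) hΛ₁ ht hsum hε1'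
  have hI₂ := integral_bubble_le (ν := riemannianVolume M) (x := z) hΛ₂ hs hssum hε1'
  have hJ₁ := le_integral_bubble (ν := riemannianVolume M) (x := x) hΛ₁ ht hsum
  have hJ₂ := le_integral_bubble (ν := riemannianVolume M) (x := z) hΛ₂ hs hssum
  have hi₁ := integrable_bubble (ν := riemannianVolume M) (x := x) hΛ₁ ht hsum
  have hi₂ := integrable_bubble (ν := riemannianVolume M) (x := z) hΛ₂ hs hssum
  have hu₁ : ∫ y, (bubble Λ₁ t x y - 1 / 2 * bubble Λ₂ s z y) ∂(riemannianVolume M)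
      = ∫ y, bubble Λ₁ t x y ∂(riemannianVolume M)
        - 1 / 2 * ∫ y, bubble Λ₂ s z y ∂(riemannianVolume M) := by
    rw [integral_sub hi₁ (hi₂.const_mul _), integral_const_mul]
  have hu₂ : ∫ y, (-(1 / 2) * bubble Λ₁ t x y + bubble Λ₂ s z y) ∂(riemannianVolume M)
      = -(1 / 2) * ∫ y, bubble Λ₁ t x y ∂(riemannianVolume M)
        + ∫ y, bubble Λ₂ s z y ∂(riemannianVolume M) := by
    rw [integral_add (hi₁.const_mul _) hi₂, integral_const_mul]
  have hM₁ := hmass₁ l Λ₁ Λ₂ t x s z hΛ₁ hΛ₂ ht hsum hx hs hssum hz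
  have hM₂ := hmass₂ k Λ₂ Λ₁ s z t x hΛ₂ hΛ₁ hs hssum hz ht hsum hx
  have hM₂' : (fun y => ENNReal.ofReal (w₂ y *
      Real.exp (bubble Λ₂ s z y - 1 / 2 * bubble Λ₁ t x y)))
      = fun y => ENNReal.ofReal (w₂ y *
        Real.exp (-(1 / 2) * bubble Λ₁ t x y + bubble Λ₂ s z y)) := by
    ext y
    congr 3
    ring
  rw [hM₂'] at hM₂
  have hlog₁ : Real.log (c₁ * (max 1 Λ₂ ^ 2 / max 1 Λ₁ ^ 2)) = Real.log c₁ + 2 * L₂ - 2 * L₁ := by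
    rw [Real.log_mul hc₁.ne' (by positivity), Real.log_div (by positivity) (by positivity),
      Real.log_pow, Real.log_pow]
    push_cast
    ring
  have hlog₂ : Real.log (c₂ * (max 1 Λ₁ ^ 2 / max 1 Λ₂ ^ 2)) = Real.log c₂ + 2 * L₁ - 2 * L₂ := by
    rw [Real.log_mul hc₂.ne' (by positivity), Real.log_div (by positivity) (by positivity),
      Real.log_pow, Real.log_pow]
    push_cast
    ring
  have hE₁ := ereal_mul_sub_log_le
    (I := ∫ y, (bubble Λ₁ t x y - 1 / 2 * bubble Λ₂ s z y) ∂(riemannianVolume M))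
    hρ₁0 (by positivity) hM₁
  have hE₂ := ereal_mul_sub_log_le
    (I := ∫ y, (-(1 / 2) * bubble Λ₁ t x y + bubble Λ₂ s z y) ∂(riemannianVolume M))
    hρ₂0 (by positivity) hM₂
  rw [hlog₁, hu₁] at hE₁
  rw [hlog₂, hu₂] at hE₂
  unfold todaFunctional
  rw [hu₁, hu₂]
  refine (add_le_add (add_le_add (EReal.coe_le_coe_iff.2 hQ) hE₁) hE₂).trans ?_
  rw [← EReal.coe_add, ← EReal.coe_add, EReal.coe_le_coe_iff]
  rw [Real.log_div one_ne_zero hε0.ne', Real.log_one, zero_sub, div_div_eq_mul_div, div_one]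
    at hI₁ hI₂
  have hB₁ := mean_sub_log_le hε0.le (c := Real.log c₁) hS₁ hI₁ hJ₂
  have hB₂ := mean_sub_log_le hε0.le (c := Real.log c₂) hS₂ hI₂ hJ₁
  rw [neg_mul, neg_add_eq_sub]
  have hB₁' := mul_le_mul_of_nonneg_left hB₁ hρ₁0
  have hB₂' := mul_le_mul_of_nonneg_left hB₂ hρ₂0
  have hS : (1 + ε) * (S₁ + S₂)
      ≤ (1 + ε) * (k * (8 * b * L₁ + C₀) + l * (8 * b * L₂ + C₀)) := by
    gcongr
  have hm₁' : min (-A₁) (-A₂) * L₁ ≤ -A₁ * L₁ := by gcongr; exact min_le_left _ _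
  have hm₂' : min (-A₁) (-A₂) * L₂ ≤ -A₂ * L₂ := by gcongr; exact min_le_right _ _
  rw [mul_add (min (-A₁) (-A₂))]
  have hfinal : (1 + ε) * (k * (8 * b * L₁ + C₀) + l * (8 * b * L₂ + C₀))
      + ρ₁ * ((-2 + 2 * ε * (k * (8 * b))) * L₁
        + (2 * ε * (k * C₀) - 2 * Real.log ε + D - Real.log c₁))
      + ρ₂ * ((-2 + 2 * ε * (l * (8 * b))) * L₂
        + (2 * ε * (l * C₀) - 2 * Real.log ε + D - Real.log c₂))
      = A₁ * L₁ + A₂ * L₂ + (1 + ε) * (k * C₀ + l * C₀)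
        + ρ₁ * (2 * ε * (k * C₀) - 2 * Real.log ε + D - Real.log c₁)
        + ρ₂ * (2 * ε * (l * C₀) - 2 * Real.log ε + D - Real.log c₂) := by
    rw [hA₁, hA₂]
    ring
  linarith

end Functional

/-! ### Test functions parametrized by the join -/

section Join

variable {M : Type*} [MetricSpace M] [MeasurableSpace M] [BorelSpace M]

/-- Every test function comes from two bubbles, with concentration parameters that add up to
`lam`. -/
lemma exists_testFunction_eq {Γ₁ Γ₂ : Set M} {k l : ℕ} {lam : ℝ} (hlam : 0 ≤ lam)
    (ζ : Join (barycenters Γ₁ k) (barycenters Γ₂ l)) :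
    ∃ (Λ₁ Λ₂ : ℝ) (t : Fin k → ℝ) (x : Fin k → M) (s : Fin l → ℝ) (z : Fin l → M),
      0 ≤ Λ₁ ∧ 0 ≤ Λ₂ ∧ Λ₁ + Λ₂ = lam ∧ (∀ j, 0 ≤ t j) ∧ ∑ j, t j = 1 ∧ (∀ j, x j ∈ Γ₁) ∧
      (∀ j, 0 ≤ s j) ∧ ∑ j, s j = 1 ∧ (∀ j, z j ∈ Γ₂) ∧
      (testFunction lam ζ).1 = (fun y => bubble Λ₁ t x y - 1 / 2 * bubble Λ₂ s z y) ∧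
      (testFunction lam ζ).2 = (fun y => -(1 / 2) * bubble Λ₁ t x y + bubble Λ₂ s z y) := by
  induction ζ using Quot.ind with
  | mk q =>
    obtain ⟨⟨σ₁, t, x, ht, hsum, hx, rfl⟩, ⟨σ₂, s, z, hs, hssum, hz, rfl⟩, r⟩ := q
    refine ⟨(1 - r) * lam, r * lam, t, x, s, z, mul_nonneg (by linarith [r.2.2]) hlam,
      mul_nonneg r.2.1 hlam, by ring, ht, hsum, hx, hs, hssum, hz, ?_, ?_⟩
    · ext y
      change logBubble _ _ y - 1 / 2 * logBubble _ _ y = _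
      rw [logBubble_sum _ t ht, logBubble_sum _ s hs]
      rfl
    · ext y
      change -(1 / 2) * logBubble _ _ y + logBubble _ _ y = _
      rw [logBubble_sum _ t ht, logBubble_sum _ s hs]
      rfl

end Join

/-- At least one of two concentration parameters with sum `lam` is at least `lam / 2`. -/
lemma log_le_log_max_add_log_max {Λ₁ Λ₂ lam : ℝ} (hlam : 0 < lam) (h : Λ₁ + Λ₂ = lam) :
    Real.log (lam / 2) ≤ Real.log (max 1 Λ₁) + Real.log (max 1 Λ₂) := by
  have h1 : 0 ≤ Real.log (max 1 Λ₁) := Real.log_nonneg (le_max_left _ _)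
  have h2 : 0 ≤ Real.log (max 1 Λ₂) := Real.log_nonneg (le_max_left _ _)
  rcases le_total Λ₁ Λ₂ with h3 | h3
  · have := Real.log_le_log (by positivity) (show lam / 2 ≤ max 1 Λ₂ from
      le_max_of_le_right (by linarith))
    linarith
  · have := Real.log_le_log (by positivity) (show lam / 2 ≤ max 1 Λ₁ from
      le_max_of_le_right (by linarith))
    linarith

end TodaSurface

end

theorem proposition3p3
    {M : Type*} [MetricSpace M] [CompactSpace M] [ConnectedSpace M]
    [MeasurableSpace M] [BorelSpace M]
    [ChartedSpace (EuclideanSpace ℝ (Fin 2)) M] [IsManifold (𝓡 2) ∞ M]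
    [RiemannianBundle (fun x : M => TangentSpace (𝓡 2) x)]
    [IsContMDiffRiemannianBundle (𝓡 2) ∞ (EuclideanSpace ℝ (Fin 2))
      (fun x : M => TangentSpace (𝓡 2) x)]
    [IsRiemannianManifold (𝓡 2) M]
    (hvol : TodaSurface.riemannianVolume M Set.univ = 1)
    {m : ℕ} (p : Fin m → M) (α₁ α₂ : Fin m → ℝ) (hα₁ : ∀ j, 0 ≤ α₁ j) (hα₂ : ∀ j, 0 ≤ α₂ j)
    (h₁ h₂ : M → ℝ) (hh₁ : ContMDiff (𝓡 2) 𝓘(ℝ, ℝ) ∞ h₁) (hh₂ : ContMDiff (𝓡 2) 𝓘(ℝ, ℝ) ∞ h₂)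
    (hh₁_pos : ∀ x, 0 < h₁ x) (hh₂_pos : ∀ x, 0 < h₂ x)
    (γ₁ γ₂ : Circle → M) (hγ₁ : Continuous γ₁) (hγ₂ : Continuous γ₂)
    (hγ₁_inj : Function.Injective γ₁) (hγ₂_inj : Function.Injective γ₂)
    (hγ_disj : Disjoint (Set.range γ₁) (Set.range γ₂))
    (hγ₁_sing : ∀ j, p j ∉ Set.range γ₁) (hγ₂_sing : ∀ j, p j ∉ Set.range γ₂)
    (k l : ℕ) (hk : 1 ≤ k) (hl : 1 ≤ l) (ρ₁ ρ₂ : ℝ)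
    (hρ₁ : ρ₁ ∈ Set.Ioo (4 * k * Real.pi) (4 * (k + 1) * Real.pi))
    (hρ₂ : ρ₂ ∈ Set.Ioo (4 * l * Real.pi) (4 * (l + 1) * Real.pi)) :
    (∀ lam : ℝ, 0 < lam → ∀ ζ : TodaSurface.Join (TodaSurface.barycenters (Set.range γ₁) k)
        (TodaSurface.barycenters (Set.range γ₂) l),
      TodaSurface.MemH1 (TodaSurface.testFunction lam ζ).1 ∧
        TodaSurface.MemH1 (TodaSurface.testFunction lam ζ).2) ∧
    ∀ L : ℝ, ∀ᶠ lam : ℝ in atTop,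
      ∀ ζ : TodaSurface.Join (TodaSurface.barycenters (Set.range γ₁) k)
        (TodaSurface.barycenters (Set.range γ₂) l),
      TodaSurface.todaFunctional ρ₁ ρ₂
        (TodaSurface.singularWeight p α₁ h₁) (TodaSurface.singularWeight p α₂ h₂)
        (TodaSurface.testFunction lam ζ).1 (TodaSurface.testFunction lam ζ).2 < (L : EReal) := by
  have : IsManifold (𝓡 2) 1 M := IsManifold.of_le (n := ∞) (by simp)
  have : IsContinuousRiemannianBundle TodaSurface.Plane (fun x : M => TangentSpace (𝓡 2) x) := by
    obtain ⟨g, hg, hg'⟩ := IsContMDiffRiemannianBundle.exists_contMDiff (IB := 𝓡 2) (n := ∞)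
      (F := EuclideanSpace ℝ (Fin 2)) (E := fun x : M => TangentSpace (𝓡 2) x)
    exact ⟨g, hg.continuous, hg'⟩
  have : IsProbabilityMeasure (TodaSurface.riemannianVolume M) := ⟨hvol⟩
  refine ⟨fun lam hlam ζ => ?_, fun L => ?_⟩
  · obtain ⟨Λ₁, Λ₂, t, x, s, z, hΛ₁, hΛ₂, -, ht, hsum, -, hs, hssum, -, h₁, h₂⟩ :=
      TodaSurface.exists_testFunction_eq hlam.le ζ
    have hv₁ := TodaSurface.lipschitzWith_bubble (x := x) hΛ₁ ht hsum
    have hv₂ := TodaSurface.lipschitzWith_bubble (x := z) hΛ₂ hs hssum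
    obtain ⟨K, hK⟩ := TodaSurface.exists_lipschitzWith_comb hv₁ hv₂ 1 (-(1 / 2))
    obtain ⟨K', hK'⟩ := TodaSurface.exists_lipschitzWith_comb hv₁ hv₂ (-(1 / 2)) 1
    rw [h₁, h₂]
    constructor
    · refine TodaSurface.memH1_of_lipschitz (K := K) ?_
      convert hK using 2
      ring
    · refine TodaSurface.memH1_of_lipschitz (K := K') ?_
      convert hK' using 2
      ring
  · have hU : IsOpen (Set.range p)ᶜ := (Set.finite_range p).isClosed.isOpen_compl
    have hw : ∀ (α : Fin m → ℝ) (h : M → ℝ), (∀ x, 0 < h x) → ∀ y ∈ (Set.range p)ᶜ,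
        0 < TodaSurface.singularWeight p α h y := fun α h hpos y _ =>
      mul_pos (hpos y) (Real.exp_pos _)
    have hsub : ∀ γ : Circle → M, (∀ j, p j ∉ Set.range γ) → Set.range γ ⊆ (Set.range p)ᶜ := by
      rintro γ hγ y hy ⟨j, rfl⟩
      exact hγ j hy
    obtain ⟨a, ha, C, hJ⟩ := TodaSurface.exists_todaFunctional_le (isCompact_range hγ₁)
      (isCompact_range hγ₂) hγ_disj hU (hsub γ₁ hγ₁_sing) (hsub γ₂ hγ₂_sing)
      (TodaSurface.continuousOn_singularWeight p α₁ hh₁.continuous)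
      (TodaSurface.continuousOn_singularWeight p α₂ hh₂.continuous)
      (hw α₁ h₁ hh₁_pos) (hw α₂ h₂ hh₂_pos) hk hl hρ₁.1 hρ₂.1
    have hlim : Tendsto (fun lam : ℝ => a * Real.log (lam / 2)) atTop atTop :=
      (Real.tendsto_log_atTop.comp (tendsto_id.atTop_div_const two_pos)).const_mul_atTop ha
    filter_upwards [hlim.eventually_gt_atTop (C - L), eventually_gt_atTop 0] with lam hlam hlam0 ζ
    obtain ⟨Λ₁, Λ₂, t, x, s, z, hΛ₁, hΛ₂, hadd, ht, hsum, hx, hs, hssum, hz, e₁, e₂⟩ :=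
      TodaSurface.exists_testFunction_eq hlam0.le ζ
    rw [e₁, e₂]
    refine (hJ Λ₁ Λ₂ t x s z hΛ₁ hΛ₂ ht hsum hx hs hssum hz).trans_lt ?_
    rw [EReal.coe_lt_coe_iff]
    have := mul_le_mul_of_nonneg_left (TodaSurface.log_le_log_max_add_log_max hlam0 hadd) ha.le
    linarith
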